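/- **Theorem (Lower bound for pure exploration with known essential graph).** *Setting.* A binary causal model on variables $\bm X=(X_1,\dots,X_n)$ and a reward $Y$, all with values in $\{0,1\}$ and without hidden variables, consists of a directed acyclic graph $G$ on $\bm X\cup\{Y\}$ in which $Y$ has no outgoing edge, and of conditional probabilities $P(v\mid \mathrm{Pa}(v))$ for every node $v$. Its observational distribution is $P(\bm X,Y)=\prod_v P(v\mid \mathrm{Pa}(v))$, and under the atomic intervention $do(X_i=b)$ the distribution is $\mathbf 1[x_i=b]\prod_{v\ne X_i}P(v\mid \mathrm{Pa}(v))$. The essential graph of $G$ is the union of all DAGs with the same skeleton and the same v-structures as $G$. Let $V\subseteq\{1,\dots,n\}$ with $\{2,\dots,n\}\subseteq V$ be the set of variables on which one can intervene (so $X_1$ may or may not be intervenable). The actions are the null intervention $do()$ and all atomic interventions $do(X_i=b)$ with $i\in V$, $b\in\{0,1\}$. An action $a$ is $\varepsilon$-optimal if $\mathbb E[Y\mid a]\ge \max_{a'}\mathbb E[Y\mid a']-\varepsilon$. In each round, an algorithm (possibly randomized) either chooses an action, based on the history, and observes all of $(\bm X,Y)$ drawn from the corresponding interventional distribution, or stops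 and outputs an action. Let $\tau\in\{0,1,2,\dots\}\cup\{\infty\}$ be the number of rounds before it stops. The algorithm is $(\varepsilon,\delta)$-PAC on a set of models if, on each of them, with probability at least $1-\delta$ it stops and outputs an $\varepsilon$-optimal action. *Statement.* There are absolute constants $c,\varepsilon_0,\delta_0>0$ and $n_0\in\mathbb N$ such that for all $n\ge n_0$, all $V$ as above and all $0<\varepsilon\le\varepsilon_0$ there are a graph $\mathcal E$, a strictly positive distribution $P(\bm X,Y)$, and a set $\mathcal I$ of binary causal models, all with essential graph $\mathcal E$ and observational distribution $P(\bm X,Y)$ and with pairwise different graphs (that is, they differ in edge directions), such that the following holds for all $0<\delta\le\delta_0$: for every algorithm that is $(\varepsilon,\delta)$-PAC on $\mathcal I$ there is an instance in $\mathcal I$ on which $$\mathbb E[\tau]\ \ge\ c\,\frac{n}{\varepsilon^2}\log\frac1\delta .$$ Since the algorithm is chosen after $\mathcal E$, $P$ and $\mathcal I$, it may depend on all of them: the bound holds even if the essential graph and the full observational distribution $P(\bm X,Y)$ are given. -/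

import Mathlib

namespace CausalBandit

open scoped ENNReal

/-- The nodes of a causal graph over `n` variables: `some i` is the variable `X_{i+1}`,
and `none` is the reward variable `Y`. -/
abbrev Node (n : ℕ) : Type := Option (Fin n)

/-- A joint value of all variables `(X, Y)`; all of them are binary. -/
abbrev Assignment (n : ℕ) : Type := Node n → Bool

/-! ### Directed acyclic graphs and essential graphs -/

/-- A directed graph without directed cycles. -/
def IsDAG {W : Type} (G : Digraph W) : Prop :=
  ∀ v, ¬ Relation.TransGen G.Adj v v

/-- `a → c ← b` with `a`, `b` distinct and not adjacent. -/
def IsVStructure {W : Type} (G : Digraph W) (a b c : W) : Prop :=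
  G.Adj a c ∧ G.Adj b c ∧ a ≠ b ∧ ¬ G.Adj a b ∧ ¬ G.Adj b a

/-- Markov equivalence of DAGs: the same skeleton and the same v-structures. -/
def MarkovEquivalent {W : Type} (G H : Digraph W) : Prop :=
  G.toSimpleGraphInclusive = H.toSimpleGraphInclusive ∧
    ∀ a b c, IsVStructure G a b c ↔ IsVStructure H a b c

/-- The essential graph of a DAG `G`: the union of all DAGs that are Markov equivalent to `G`.
An edge whose direction is not determined by the equivalence class appears in both directions
(that is, as an undirected edge); the other edges are directed. -/
def essentialGraph {W : Type} (G : Digraph W) : Digraph W where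
  Adj u v := ∃ H : Digraph W, IsDAG H ∧ MarkovEquivalent G H ∧ H.Adj u v

/-! ### Binary causal models -/

/-- A binary causal model (causal Bayesian network without hidden variables) over
`X_1, …, X_n, Y`, in which `Y` has no outgoing edge. `cpt v x` is the conditional probability
that `v` has value `1`, given that the parents of `v` have the values that `x` assigns to them. -/
structure CausalModel (n : ℕ) where
  graph : Digraph (Node n)
  isDAG : IsDAG graph
  reward_sink : ∀ v, ¬ graph.Adj none v
  cpt : Node n → Assignment n → ℝ
  cpt_nonneg : ∀ v x, 0 ≤ cpt v x
  cpt_le_one : ∀ v x, cpt v x ≤ 1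
  cpt_parents : ∀ v x x', (∀ u, graph.Adj u v → x u = x' u) → cpt v x = cpt v x'

/-- The null intervention `do()` (`none`), and the atomic interventions `do(X_i = b)`
(`some (i, b)`) on the variables with index in `V`. -/
abbrev Action {n : ℕ} (V : Finset (Fin n)) : Type := Option ({i : Fin n // i ∈ V} × Bool)

namespace CausalModel

variable {n : ℕ} (M : CausalModel n)

/-- The probability of the value `x v` of `v`, given the values in `x` of the parents of `v`. -/
def nodeProb (v : Node n) (x : Assignment n) : ℝ :=
  if x v = true then M.cpt v x else 1 - M.cpt v x

/-- The observational distribution `P(X, Y)`. -/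
def obsDist (x : Assignment n) : ℝ :=
  ∏ v, M.nodeProb v x

/-- The interventional distribution `P(X, Y | a)` (truncated factorization). -/
def doDist {V : Finset (Fin n)} (a : Action V) (x : Assignment n) : ℝ :=
  match a with
  | none => M.obsDist x
  | some (i, b) =>
      if x (some i.1) = b then ∏ v ∈ Finset.univ.erase (some i.1), M.nodeProb v x else 0

/-- The expected reward `E[Y | a]`. -/
def mean {V : Finset (Fin n)} (a : Action V) : ℝ :=
  ∑ x : Assignment n, M.doDist a x * (if x none = true then 1 else 0)

/-- `a` is an `ε`-optimal action among the available ones. -/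
def IsEpsOptimal {V : Finset (Fin n)} (ε : ℝ) (a : Action V) : Prop :=
  ∀ a' : Action V, M.mean a' - ε ≤ M.mean a

end CausalModel

/-! ### Pure exploration algorithms -/

/-- The rounds played so far, the most recent one first: the action of each round, and the values
of all variables that were observed in it. -/
abbrev History {n : ℕ} (V : Finset (Fin n)) : Type := List (Action V × Assignment n)

/-- What an algorithm does next: play another round with an action, or stop and output an action. -/
inductive Decision {n : ℕ} (V : Finset (Fin n)) : Type where
  | play (a : Action V)
  | output (a : Action V)

/-- A sequential, possibly randomized algorithm: given the history, it draws its next decision. -/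
abbrev Algorithm {n : ℕ} (V : Finset (Fin n)) : Type := History V → PMF (Decision V)

section Run

variable {n : ℕ} {V : Finset (Fin n)} (M : CausalModel n) (π : Algorithm V)

/-- The probability that the algorithm, run on `M`, plays at least `h.length` rounds and that the
first `h.length` rounds are those listed in `h`. -/
noncomputable def histProb : History V → ℝ≥0∞
  | [] => 1
  | (a, x) :: h => histProb h * π h (Decision.play a) * ENNReal.ofReal (M.doDist a x)

/-- The probability that the algorithm stops exactly after the rounds in `h` and outputs `b`. -/
noncomputable def outcomeProb (h : History V) (b : Action V) : ℝ≥0∞ :=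
  histProb M π h * π h (Decision.output b)

/-- The probability that the algorithm ever stops. -/
noncomputable def haltProb : ℝ≥0∞ :=
  ∑' h : History V, ∑ b : Action V, outcomeProb M π h b

/-- The expected number of rounds `E[τ]` on `M`; here `τ = ∞` if the algorithm never stops
(and `∞ * 0 = 0`). -/
noncomputable def expectedSamples : ℝ≥0∞ :=
  (∑' h : History V, ∑ b : Action V, (h.length : ℝ≥0∞) * outcomeProb M π h b) +
    ⊤ * (1 - haltProb M π)

open Classical in
/-- The probability that the algorithm stops and outputs an `ε`-optimal action of `M`. -/
noncomputable def successProb (ε : ℝ) : ℝ≥0∞ :=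
  ∑' h : History V, ∑ b : Action V, if M.IsEpsOptimal ε b then outcomeProb M π h b else 0

end Run

/-- The algorithm is `(ε, δ)`-PAC on the instances in `I`: on each of them it outputs an
`ε`-optimal action with probability at least `1 - δ`. -/
def IsPAC {n : ℕ} {V : Finset (Fin n)} (I : Set (CausalModel n)) (ε δ : ℝ) (π : Algorithm V) :
    Prop :=
  ∀ M ∈ I, ENNReal.ofReal (1 - δ) ≤ successProb M π ε

end CausalBandit

/-! All models share a star: a fair hub `X_0` with `m = n - 2` leaves, and an isolated fair variable
`X_1`, all of them parents of `Y`. In `model 0` every star edge leaves the hub; in `model k` the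
edge to leaf `k` is reversed, with conditionals given by Bayes' rule. A single reversal creates no
collider at the hub, so the essential graph and the observational distribution do not change
(`essentialGraph_starGraph`, `obsDist_model`).

Setting `X_1 = 1` gives the safe mean `α`. With `X_1 = 0` the reward is high only if the hub and
some leaf are 1. Leaves are rarely 1, so it pays to force one, but in `model 0` the hub then stays a
fair coin and the safe action is the only `ε`-optimal one. In `model k`, forcing leaf `k` to 1 also
tilts the hub towards 1 by order `η`, which is of order `ε`, and the safe action is no longer
`ε`-optimal (`mean_model_zero_le`, `mean_reversed`).

Hence a PAC algorithm run on `model 0` must rule out every `model k`. By `doDist_model`, only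
interventions on leaf `k` or on the hub distinguish `model k` from `model 0`. The former carry
information of order `η²` about that one leaf; the latter concern all leaves at once, but only with
order `p η²` each, where `p` is of order `1/m`. So a round yields at most `2 η²` in total over all
leaves (`sum_infoBound_le`), whereas each leaf requires order `log (1/δ)` (`le_weightedSamples`).
Summing over the leaves bounds `E[τ]` on `model 0` below by order `m log (1/δ) / η²`. -/

namespace CausalBandit
open scoped ENNReal

/-! ### Histories of a given length -/

section Lists

variable {α : Type} [Fintype α]

/-- The lists of length `t`. -/
noncomputable def listsOfLength (α : Type) [Fintype α] (t : ℕ) : Finset (List α) :=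
  (List.finite_length_eq α t).toFinset

theorem mem_listsOfLength {t : ℕ} {l : List α} : l ∈ listsOfLength α t ↔ l.length = t := by
  simp [listsOfLength]

theorem listsOfLength_zero : listsOfLength α 0 = {[]} := by
  ext l
  simp [mem_listsOfLength]

theorem sum_listsOfLength_succ {R : Type} [AddCommMonoid R] (t : ℕ) (F : List α → R) :
    ∑ l ∈ listsOfLength α (t + 1), F l = ∑ l ∈ listsOfLength α t, ∑ e : α, F (e :: l) := by
  rw [← Finset.sum_product']
  symm
  refine Finset.sum_bij (fun q _ => q.2 :: q.1) ?_ ?_ ?_ ?_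
  · rintro ⟨l, e⟩ h
    simp only [Finset.mem_product, mem_listsOfLength] at h
    simp [mem_listsOfLength, h.1]
  · rintro ⟨l, e⟩ _ ⟨l', e'⟩ _ h
    simp only [List.cons.injEq] at h
    simp [h.1, h.2]
  · intro l hl
    rw [mem_listsOfLength] at hl
    cases l with
    | nil => simp at hl
    | cons e l =>
      exact ⟨(l, e), by simpa [mem_listsOfLength] using hl, rfl⟩
  · intros
    rfl

/-- Splitting runs by length turns statements about infinitely many histories into finite sums per
round, so no measure on infinite trajectories is needed. -/
theorem tsum_eq_tsum_listsOfLength (F : List α → ℝ≥0∞) :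
    ∑' l, F l = ∑' t, ∑ l ∈ listsOfLength α t, F l := by
  have h : ∀ t, ∑ l ∈ listsOfLength α t, F l = ∑' l : List α, if t = l.length then F l else 0 := by
    intro t
    rw [tsum_eq_sum (s := listsOfLength α t)]
    · refine Finset.sum_congr rfl fun l hl => ?_
      rw [if_pos (mem_listsOfLength.1 hl).symm]
    · intro l hl
      rw [if_neg]
      exact fun h => hl (mem_listsOfLength.2 h.symm)
  simp_rw [h]
  rw [ENNReal.tsum_comm]
  simp [tsum_ite_eq]

end Lists

/-! ### Runs of an algorithm -/

section Runs

variable {n : ℕ} {V : Finset (Fin n)}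

/-- The interventional distributions of `M` are probability distributions. -/
def IsNormalized (V : Finset (Fin n)) (M : CausalModel n) : Prop :=
  ∀ a : Action V, ∑ x, M.doDist a x = 1

theorem CausalModel.nodeProb_nonneg (M : CausalModel n) (v : Node n) (x : Assignment n) :
    0 ≤ M.nodeProb v x := by
  unfold CausalModel.nodeProb
  split_ifs
  · exact M.cpt_nonneg v x
  · linarith [M.cpt_le_one v x]

theorem CausalModel.doDist_nonneg (M : CausalModel n) (a : Action V) (x : Assignment n) :
    0 ≤ M.doDist a x := by
  rcases a with _ | ⟨i, b⟩
  · unfold CausalModel.doDist CausalModel.obsDist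
    exact Finset.prod_nonneg fun v _ => M.nodeProb_nonneg v x
  · simp only [CausalModel.doDist]
    split_ifs
    · exact Finset.prod_nonneg fun v _ => M.nodeProb_nonneg v x
    · exact le_rfl

theorem sum_play_add_sum_output (π : Algorithm V) (h : History V) :
    ∑ a, π h (.play a) + ∑ b, π h (.output b) = 1 := by
  let e : Action V ⊕ Action V ≃ Decision V :=
    { toFun := Sum.elim .play .output
      invFun := fun d => match d with
        | .play a => .inl a
        | .output a => .inr a
      left_inv := by rintro (a | a) <;> rfl
      right_inv := by rintro (a | a) <;> rfl }
  rw [← (π h).tsum_coe, ← e.tsum_eq, tsum_fintype, Fintype.sum_sum_type]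
  rfl

/-- The probability that at least `t` rounds are played. -/
noncomputable def reachProb (M : CausalModel n) (π : Algorithm V) (t : ℕ) : ℝ≥0∞ :=
  ∑ h ∈ listsOfLength (Action V × Assignment n) t, histProb M π h

/-- The probability that exactly `t` rounds are played. -/
noncomputable def stopProb (M : CausalModel n) (π : Algorithm V) (t : ℕ) : ℝ≥0∞ :=
  ∑ h ∈ listsOfLength (Action V × Assignment n) t, ∑ b, outcomeProb M π h b

variable {M : CausalModel n} {π : Algorithm V}

theorem reachProb_zero : reachProb M π 0 = 1 := by
  simp [reachProb, listsOfLength_zero, histProb]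

theorem sum_ofReal_doDist (hM : IsNormalized V M) (a : Action V) :
    ∑ x, ENNReal.ofReal (M.doDist a x) = 1 := by
  rw [← ENNReal.ofReal_sum_of_nonneg fun x _ => M.doDist_nonneg a x, hM a, ENNReal.ofReal_one]

theorem reachProb_succ (hM : IsNormalized V M) (t : ℕ) :
    reachProb M π (t + 1) = ∑ h ∈ listsOfLength (Action V × Assignment n) t,
      histProb M π h * ∑ a, π h (.play a) := by
  rw [reachProb, sum_listsOfLength_succ]
  refine Finset.sum_congr rfl fun h _ => ?_
  rw [Fintype.sum_prod_type, Finset.mul_sum]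
  refine Finset.sum_congr rfl fun a _ => ?_
  simp only [histProb]
  rw [← Finset.mul_sum, sum_ofReal_doDist hM, mul_one]

theorem reachProb_succ_add_stopProb (hM : IsNormalized V M) (t : ℕ) :
    reachProb M π (t + 1) + stopProb M π t = reachProb M π t := by
  rw [reachProb_succ hM, stopProb, ← Finset.sum_add_distrib]
  refine Finset.sum_congr rfl fun h _ => ?_
  simp only [outcomeProb]
  rw [← Finset.mul_sum, ← mul_add, sum_play_add_sum_output, mul_one]

theorem reachProb_add_sum_stopProb (hM : IsNormalized V M) (T : ℕ) :
    reachProb M π T + ∑ t ∈ Finset.range T, stopProb M π t = 1 := by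
  induction T with
  | zero => simp [reachProb_zero]
  | succ T ih =>
    rw [Finset.sum_range_succ, add_comm (∑ t ∈ Finset.range T, _), ← add_assoc,
      reachProb_succ_add_stopProb hM, ih]

theorem haltProb_eq_tsum_stopProb : haltProb M π = ∑' t, stopProb M π t :=
  tsum_eq_tsum_listsOfLength _

theorem haltProb_le_one (hM : IsNormalized V M) : haltProb M π ≤ 1 := by
  rw [haltProb_eq_tsum_stopProb, ENNReal.tsum_eq_iSup_nat]
  exact iSup_le fun T => (reachProb_add_sum_stopProb (π := π) hM T) ▸ le_add_self

theorem reachProb_le_one (hM : IsNormalized V M) (T : ℕ) : reachProb M π T ≤ 1 :=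
  (reachProb_add_sum_stopProb (π := π) hM T) ▸ le_self_add

theorem histProb_ne_top (M : CausalModel n) (π : Algorithm V) (h : History V) :
    histProb M π h ≠ ⊤ := by
  induction h with
  | nil => simp [histProb]
  | cons e h ih =>
    simp only [histProb]
    exact ENNReal.mul_ne_top (ENNReal.mul_ne_top ih ((π h).apply_ne_top _)) ENNReal.ofReal_ne_top

theorem reachProb_eq_tsum_stopProb (hM : IsNormalized V M) (hh : haltProb M π = 1) (T : ℕ) :
    reachProb M π T = ∑' t, stopProb M π (t + T) := by
  have h1 := reachProb_add_sum_stopProb (π := π) hM T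
  rw [← hh, haltProb_eq_tsum_stopProb,
    ← ENNReal.summable.sum_add_tsum_nat_add' (f := stopProb M π) (k := T), add_comm] at h1
  refine (ENNReal.add_right_inj ?_).1 h1
  have h2 := reachProb_add_sum_stopProb (π := π) hM T
  refine ne_top_of_le_ne_top ENNReal.one_ne_top ?_
  rw [← h2]
  exact le_add_self

/-- The expected number of rounds is at least the sum of the tail probabilities. -/
theorem sum_reachProb_le_expectedSamples (hM : IsNormalized V M) (T : ℕ) :
    ∑ t ∈ Finset.range T, reachProb M π (t + 1) ≤ expectedSamples M π := by
  -- If halting is not almost sure, the second summand of `expectedSamples` is infinite. Otherwise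
  -- each tail is the sum of the later stopping probabilities, and a run of `s` rounds is counted at
  -- most `s` times.
  by_cases hh : haltProb M π = 1
  · have h1 : ∀ t, reachProb M π (t + 1) = ∑' s, if t < s then stopProb M π s else 0 := by
      intro t
      rw [reachProb_eq_tsum_stopProb hM hh,
        ← ENNReal.summable.sum_add_tsum_nat_add' (k := t + 1)
          (f := fun s => if t < s then stopProb M π s else 0)]
      rw [Finset.sum_eq_zero, zero_add]
      · refine tsum_congr fun s => ?_
        rw [if_pos (by omega)]
      · intro s hs
        rw [if_neg]
        have := Finset.mem_range.1 hs
        omega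
    have h2 : (∑' h : History V, ∑ b : Action V, (h.length : ℝ≥0∞) * outcomeProb M π h b) =
        ∑' s : ℕ, (s : ℝ≥0∞) * stopProb M π s := by
      rw [tsum_eq_tsum_listsOfLength]
      refine tsum_congr fun s => ?_
      rw [stopProb, Finset.mul_sum]
      refine Finset.sum_congr rfl fun h hl => ?_
      rw [mem_listsOfLength.1 hl, Finset.mul_sum]
    refine le_trans ?_ le_self_add
    simp_rw [h1]
    rw [h2, ← Summable.tsum_finsetSum fun _ _ => ENNReal.summable]
    refine ENNReal.tsum_le_tsum fun s => ?_
    rw [← Finset.sum_filter, Finset.sum_const, nsmul_eq_mul]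
    gcongr
    calc (Finset.filter (fun t => t < s) (Finset.range T)).card
        ≤ (Finset.range s).card := Finset.card_le_card fun t ht => by
          simp only [Finset.mem_filter, Finset.mem_range] at ht ⊢
          exact ht.2
      _ = s := Finset.card_range s
  · have h1 : (1 : ℝ≥0∞) - haltProb M π ≠ 0 := by
      rw [Ne, tsub_eq_zero_iff_le, not_le]
      exact lt_of_le_of_ne (haltProb_le_one hM) hh
    rw [expectedSamples, ENNReal.top_mul h1]
    simp

/-- The probability that the algorithm stops after fewer than `T` rounds and outputs `b`. -/
noncomputable def outputBefore (M : CausalModel n) (π : Algorithm V) (b : Action V) (T : ℕ) :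
    ℝ≥0∞ :=
  ∑ t ∈ Finset.range T, ∑ h ∈ listsOfLength (Action V × Assignment n) t, outcomeProb M π h b

theorem outputBefore_le_stopProb (b : Action V) (T : ℕ) :
    outputBefore M π b T ≤ ∑ t ∈ Finset.range T, stopProb M π t := by
  refine Finset.sum_le_sum fun t _ => Finset.sum_le_sum fun h _ => ?_
  exact Finset.single_le_sum (f := fun b => outcomeProb M π h b) (fun _ _ => zero_le)
    (Finset.mem_univ b)

theorem outputBefore_ne_top (hM : IsNormalized V M) (b : Action V) (T : ℕ) :
    outputBefore M π b T ≠ ⊤ := by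
  refine ne_top_of_le_ne_top ENNReal.one_ne_top ((outputBefore_le_stopProb b T).trans ?_)
  rw [← reachProb_add_sum_stopProb (π := π) hM T]
  exact le_add_self

/-- If `b` is the only `ε`-optimal action, then it is output with the success probability. -/
theorem exists_lt_outputBefore {ε : ℝ} {b : Action V} (hb : ∀ a, M.IsEpsOptimal ε a → a = b)
    {r : ℝ≥0∞} (hr : r < successProb M π ε) : ∃ T, r < outputBefore M π b T := by
  have h1 : successProb M π ε ≤ ∑' h, outcomeProb M π h b := by
    refine ENNReal.tsum_le_tsum fun h => ?_
    classical
    calc _ ≤ ∑ a : Action V, if a = b then outcomeProb M π h a else 0 := by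
          refine Finset.sum_le_sum fun a _ => ?_
          split_ifs with h1 h2 h2
          · exact le_rfl
          · exact absurd (hb a h1) h2
          · exact zero_le
          · exact le_rfl
      _ = outcomeProb M π h b := by simp
  have h2 := hr.trans_le h1
  rw [tsum_eq_tsum_listsOfLength, ENNReal.tsum_eq_iSup_nat] at h2
  exact lt_iSup_iff.1 h2

/-- An action that is not `ε`-optimal is output with at most the failure probability. -/
theorem outputBefore_add_successProb_le {ε : ℝ} {b : Action V} (hM : IsNormalized V M)
    (hb : ¬ M.IsEpsOptimal ε b) (T : ℕ) : outputBefore M π b T + successProb M π ε ≤ 1 := by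
  classical
  have h1 : outputBefore M π b T ≤ ∑' h, outcomeProb M π h b := by
    rw [tsum_eq_tsum_listsOfLength]
    exact ENNReal.sum_le_tsum _
  refine le_trans ?_ (haltProb_le_one (π := π) hM)
  refine (add_le_add_left h1 _).trans ?_
  rw [successProb, haltProb, ← ENNReal.tsum_add]
  refine ENNReal.tsum_le_tsum fun h => ?_
  rw [← Finset.add_sum_erase _ _ (Finset.mem_univ b), if_neg hb, zero_add,
    ← Finset.add_sum_erase _ _ (Finset.mem_univ b)]
  gcongr
  split_ifs
  · exact le_rfl
  · exact zero_le

/-! ### Change of measure -/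

/-- The sum of `L` over the rounds of a history. -/
def sumRounds (L : Action V → Assignment n → ℝ) : History V → ℝ
  | [] => 0
  | (a, x) :: h => sumRounds L h + L a x

/-- The expected number of rounds among the first `T` ones, each weighted by `d` of its action. -/
noncomputable def weightedSamples (M : CausalModel n) (π : Algorithm V) (T : ℕ)
    (d : Action V → ℝ) : ℝ :=
  ∑ t ∈ Finset.range T, ∑ h ∈ listsOfLength (Action V × Assignment n) t,
    (histProb M π h).toReal * ∑ a, (π h (.play a)).toReal * d a

theorem sum_toReal_play_add_sum_toReal_output (π : Algorithm V) (h : History V) :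
    ∑ a, (π h (.play a)).toReal + ∑ b, (π h (.output b)).toReal = 1 := by
  rw [← ENNReal.toReal_sum fun a _ => (π h).apply_ne_top _,
    ← ENNReal.toReal_sum fun a _ => (π h).apply_ne_top _, ← ENNReal.toReal_add,
    sum_play_add_sum_output, ENNReal.toReal_one]
  · exact ENNReal.sum_ne_top.2 fun a _ => (π h).apply_ne_top _
  · exact ENNReal.sum_ne_top.2 fun a _ => (π h).apply_ne_top _

theorem sum_histProb_mul_succ (F : History V → ℝ) (t : ℕ) :
    ∑ h ∈ listsOfLength (Action V × Assignment n) (t + 1), (histProb M π h).toReal * F h =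
      ∑ h ∈ listsOfLength (Action V × Assignment n) t, (histProb M π h).toReal *
        ∑ a, (π h (.play a)).toReal * ∑ x, M.doDist a x * F ((a, x) :: h) := by
  rw [sum_listsOfLength_succ]
  refine Finset.sum_congr rfl fun h _ => ?_
  rw [Fintype.sum_prod_type, Finset.mul_sum]
  refine Finset.sum_congr rfl fun a _ => ?_
  rw [Finset.mul_sum, Finset.mul_sum]
  refine Finset.sum_congr rfl fun x _ => ?_
  simp only [histProb, ENNReal.toReal_mul, ENNReal.toReal_ofReal (M.doDist_nonneg a x)]
  ring

/-- Wald's identity for the algorithm truncated at `T` rounds. -/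
theorem sum_sumRounds_eq (hM : IsNormalized V M) (L : Action V → Assignment n → ℝ) (T : ℕ) :
    ∑ t ∈ Finset.range T, ∑ h ∈ listsOfLength (Action V × Assignment n) t,
        (histProb M π h).toReal * ((∑ b, (π h (.output b)).toReal) * sumRounds L h) +
      ∑ h ∈ listsOfLength (Action V × Assignment n) T, (histProb M π h).toReal * sumRounds L h =
    weightedSamples M π T fun a => ∑ x, M.doDist a x * L a x := by
  induction T with
  | zero => simp [weightedSamples, listsOfLength_zero, sumRounds]
  | succ T ih =>
    rw [weightedSamples, Finset.sum_range_succ, Finset.sum_range_succ, ← weightedSamples, ← ih,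
      sum_histProb_mul_succ, add_assoc, add_assoc, ← Finset.sum_add_distrib,
      ← Finset.sum_add_distrib]
    congr 1
    refine Finset.sum_congr rfl fun h _ => ?_
    rw [← mul_add, ← mul_add]
    congr 1
    have h1 : ∀ a, ∑ x, M.doDist a x * sumRounds L ((a, x) :: h) =
        sumRounds L h + ∑ x, M.doDist a x * L a x := by
      intro a
      simp only [sumRounds, mul_add, Finset.sum_add_distrib]
      rw [← Finset.sum_mul, hM a, one_mul]
    simp_rw [h1, mul_add, Finset.sum_add_distrib]
    rw [← add_assoc, ← Finset.sum_mul, ← add_mul, add_comm (∑ b, _),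
      sum_toReal_play_add_sum_toReal_output, one_mul]

/-- The algorithm's own decision probabilities do not depend on the model and cancel, so only the
per-round likelihood ratios accumulate. -/
theorem histProb_toReal_change {M' : CausalModel n} {L : Action V → Assignment n → ℝ}
    (hL : ∀ a x, M'.doDist a x = M.doDist a x * Real.exp (-L a x)) (h : History V) :
    (histProb M' π h).toReal = (histProb M π h).toReal * Real.exp (-sumRounds L h) := by
  induction h with
  | nil => simp [histProb, sumRounds]
  | cons e h ih =>
    obtain ⟨a, x⟩ := e
    simp only [histProb, sumRounds, ENNReal.toReal_mul,
      ENNReal.toReal_ofReal (CausalModel.doDist_nonneg _ a x), ih]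
    rw [hL a x, neg_add, Real.exp_add]
    ring

theorem toReal_reachProb (M : CausalModel n) (π : Algorithm V) (T : ℕ) :
    (reachProb M π T).toReal = ∑ h ∈ listsOfLength (Action V × Assignment n) T,
      (histProb M π h).toReal :=
  ENNReal.toReal_sum fun h _ => histProb_ne_top M π h

theorem toReal_outputBefore (M : CausalModel n) (π : Algorithm V) (b : Action V) (T : ℕ) :
    (outputBefore M π b T).toReal = ∑ t ∈ Finset.range T,
      ∑ h ∈ listsOfLength (Action V × Assignment n) t,
        (histProb M π h).toReal * (π h (.output b)).toReal := by
  have h0 : ∀ h, outcomeProb M π h b ≠ ⊤ := fun h =>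
    ENNReal.mul_ne_top (histProb_ne_top M π h) ((π h).apply_ne_top _)
  rw [outputBefore, ENNReal.toReal_sum fun t _ => ENNReal.sum_ne_top.2 fun h _ => h0 h]
  refine Finset.sum_congr rfl fun t _ => ?_
  rw [ENNReal.toReal_sum fun h _ => h0 h]
  simp only [outcomeProb, ENNReal.toReal_mul]

theorem sum_toReal_mass (hM : IsNormalized V M) (T : ℕ) :
    ∑ t ∈ Finset.range T, ∑ h ∈ listsOfLength (Action V × Assignment n) t,
        (histProb M π h).toReal * ∑ b, (π h (.output b)).toReal +
      ∑ h ∈ listsOfLength (Action V × Assignment n) T, (histProb M π h).toReal = 1 := by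
  have h1 := reachProb_add_sum_stopProb (π := π) hM T
  have h2 : ∀ h b, outcomeProb M π h b ≠ ⊤ := fun h b =>
    ENNReal.mul_ne_top (histProb_ne_top M π h) ((π h).apply_ne_top _)
  have h3 : ∀ t, stopProb M π t ≠ ⊤ := fun t =>
    ENNReal.sum_ne_top.2 fun h _ => ENNReal.sum_ne_top.2 fun b _ => h2 h b
  have h4 := congrArg ENNReal.toReal h1
  rw [ENNReal.toReal_add (ne_top_of_le_ne_top ENNReal.one_ne_top (reachProb_le_one hM T))
    (ENNReal.sum_ne_top.2 fun t _ => h3 t), ENNReal.toReal_sum fun t _ => h3 t,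
    ENNReal.toReal_one, toReal_reachProb, add_comm] at h4
  rw [← h4]
  congr 1
  refine Finset.sum_congr rfl fun t _ => ?_
  rw [stopProb, ENNReal.toReal_sum fun h _ => ENNReal.sum_ne_top.2 fun b _ => h2 h b]
  refine Finset.sum_congr rfl fun h _ => ?_
  rw [ENNReal.toReal_sum fun b _ => h2 h b, Finset.mul_sum]
  simp only [outcomeProb, ENNReal.toReal_mul]

/-- The information that the first `T` rounds have to provide about the alternative `M'`, if the
output `b` is much less likely under `M'` than under `M`. -/
theorem le_weightedSamples {M' : CausalModel n} {L : Action V → Assignment n → ℝ}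
    (hM : IsNormalized V M) (hM' : IsNormalized V M')
    (hL : ∀ a x, M'.doDist a x = M.doDist a x * Real.exp (-L a x)) (b : Action V) (T : ℕ) {g : ℝ} :
    (outputBefore M π b T).toReal * g - (outputBefore M' π b T).toReal * Real.exp g ≤
      weightedSamples M π T fun a => ∑ x, M.doDist a x * L a x := by
  classical
  -- This is `1 + u ≤ exp u` at `u = c - sumRounds L h`, multiplied by the probability of `h` under
  -- `M`. The constant `c` may be chosen separately for each outcome.
  have key : ∀ (h : History V) (c : ℝ), (histProb M π h).toReal * (1 + c) -
      (histProb M' π h).toReal * Real.exp c ≤ (histProb M π h).toReal * sumRounds L h := by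
    intro h c
    rw [histProb_toReal_change hL]
    have h1 := Real.add_one_le_exp (c - sumRounds L h)
    rw [sub_eq_add_neg, add_comm c, Real.exp_add] at h1
    nlinarith [mul_le_mul_of_nonneg_left h1 (ENNReal.toReal_nonneg (a := histProb M π h))]
  rw [← sum_sumRounds_eq hM]
  -- Runs still active after `T` rounds use `c = 0`.
  have hleaf : ∑ h ∈ listsOfLength (Action V × Assignment n) T, (histProb M π h).toReal -
      ∑ h ∈ listsOfLength (Action V × Assignment n) T, (histProb M' π h).toReal ≤
      ∑ h ∈ listsOfLength (Action V × Assignment n) T,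
        (histProb M π h).toReal * sumRounds L h := by
    rw [← Finset.sum_sub_distrib]
    refine Finset.sum_le_sum fun h _ => ?_
    simpa using key h 0
  -- Output `b` uses `c = g`, every other output `c = 0`. The extra `M'`-mass of output `b`
  -- subtracted on the left only weakens the bound, and lets the total masses of `M` and `M'` cancel
  -- in the sum.
  have hend : ∀ h, (histProb M π h).toReal * (∑ b, (π h (.output b)).toReal) +
      (histProb M π h).toReal * (π h (.output b)).toReal * g -
      ((histProb M' π h).toReal * (∑ b, (π h (.output b)).toReal) +
      (histProb M' π h).toReal * (π h (.output b)).toReal * Real.exp g) ≤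
      (histProb M π h).toReal * ((∑ b, (π h (.output b)).toReal) * sumRounds L h) := by
    intro h
    rw [← Finset.add_sum_erase _ _ (Finset.mem_univ b)]
    set o := ∑ b ∈ Finset.univ.erase b, (π h (.output b)).toReal with ho
    have ho0 : 0 ≤ o := Finset.sum_nonneg fun _ _ => ENNReal.toReal_nonneg
    have h0 := mul_le_mul_of_nonneg_left (key h 0) ho0
    have h1 := mul_le_mul_of_nonneg_left (key h g)
      (ENNReal.toReal_nonneg (a := π h (.output b)))
    have h2 : 0 ≤ (histProb M' π h).toReal * (π h (.output b)).toReal :=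
      mul_nonneg ENNReal.toReal_nonneg ENNReal.toReal_nonneg
    rw [Real.exp_zero] at h0
    nlinarith
  have hsum := Finset.sum_le_sum fun t (_ : t ∈ Finset.range T) => Finset.sum_le_sum
    fun h (_ : h ∈ listsOfLength (Action V × Assignment n) t) => hend h
  simp only [Finset.sum_add_distrib, Finset.sum_sub_distrib, ← Finset.sum_mul] at hsum
  rw [← toReal_outputBefore, ← toReal_outputBefore] at hsum
  linarith [sum_toReal_mass (π := π) hM T, sum_toReal_mass (π := π) hM' T]

theorem weightedSamples_mono {d d' : Action V → ℝ} (h : ∀ a, d a ≤ d' a) (T : ℕ) :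
    weightedSamples M π T d ≤ weightedSamples M π T d' := by
  refine Finset.sum_le_sum fun t _ => Finset.sum_le_sum fun l _ => ?_
  refine mul_le_mul_of_nonneg_left ?_ ENNReal.toReal_nonneg
  exact Finset.sum_le_sum fun a _ => mul_le_mul_of_nonneg_left (h a) ENNReal.toReal_nonneg

theorem sum_weightedSamples {ι : Type} (s : Finset ι) (d : ι → Action V → ℝ) (T : ℕ) :
    ∑ i ∈ s, weightedSamples M π T (d i) = weightedSamples M π T fun a => ∑ i ∈ s, d i a := by
  unfold weightedSamples
  rw [Finset.sum_comm]
  refine Finset.sum_congr rfl fun t _ => ?_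
  rw [Finset.sum_comm]
  refine Finset.sum_congr rfl fun h _ => ?_
  rw [← Finset.mul_sum, Finset.sum_comm]
  simp_rw [Finset.mul_sum]

/-- With constant weight `D`, the weighted count is `D` times the sum of the tail probabilities of
`τ` up to `T`. -/
theorem ofReal_weightedSamples_const_le (hM : IsNormalized V M) (T : ℕ) {D B : ℝ} (hD : 0 < D)
    (hB : B * D ≤ weightedSamples M π T fun _ => D) :
    ENNReal.ofReal B ≤ expectedSamples M π := by
  refine le_trans ?_ (sum_reachProb_le_expectedSamples (π := π) hM T)
  have h1 : ∀ t, reachProb M π t ≠ ⊤ := fun t =>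
    ne_top_of_le_ne_top ENNReal.one_ne_top (reachProb_le_one hM t)
  rw [ENNReal.ofReal_le_iff_le_toReal (ENNReal.sum_ne_top.2 fun t _ => h1 _),
    ENNReal.toReal_sum fun t _ => h1 _]
  refine le_of_mul_le_mul_right (hB.trans_eq ?_) hD
  rw [weightedSamples, Finset.sum_mul]
  refine Finset.sum_congr rfl fun t _ => ?_
  have h2 : ∀ h : History V, ∑ a, π h (.play a) ≠ ⊤ := fun h =>
    ENNReal.sum_ne_top.2 fun a _ => (π h).apply_ne_top _
  rw [reachProb_succ hM, ENNReal.toReal_sum fun h _ =>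
    ENNReal.mul_ne_top (histProb_ne_top M π h) (h2 h), Finset.sum_mul]
  refine Finset.sum_congr rfl fun h _ => ?_
  rw [ENNReal.toReal_mul, ENNReal.toReal_sum fun a _ => (π h).apply_ne_top _, ← Finset.sum_mul,
    mul_assoc]

end Runs

/-! ### Reversing one edge of a star -/

section Graph

variable {m : ℕ}

/-- The star with hub `X_0` and leaves `X_i`, `i ≠ 0, 1`, in which the edge between `X_0` and `X_k`
is reversed if `X_k` is a leaf; all variables are parents of the reward. -/
def starGraph (k : Fin (m + 2)) : Digraph (Node (m + 2)) where
  Adj u v := match u, v with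
    | some _, none => True
    | some u, some v => (u = 0 ∧ v ≠ 0 ∧ v ≠ 1 ∧ v ≠ k) ∨ (v = 0 ∧ u = k ∧ k ≠ 0 ∧ k ≠ 1)
    | none, _ => False

theorem starGraph_adj_none (k u : Fin (m + 2)) : (starGraph k).Adj (some u) none := trivial

theorem starGraph_not_adj (k : Fin (m + 2)) (v : Node (m + 2)) : ¬ (starGraph k).Adj none v :=
  id

theorem starGraph_adj_some {k u v : Fin (m + 2)} : (starGraph k).Adj (some u) (some v) ↔
    (u = 0 ∧ v ≠ 0 ∧ v ≠ 1 ∧ v ≠ k) ∨ (v = 0 ∧ u = k ∧ k ≠ 0 ∧ k ≠ 1) := Iff.rfl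

theorem starGraph_isDAG (k : Fin (m + 2)) : IsDAG (starGraph k) := by
  -- A topological order: reversed leaf, hub, remaining leaves, reward.
  let rank : Node (m + 2) → ℕ := fun v => match v with
    | none => 3
    | some u => if u = 0 then 1 else if u = k then 0 else 2
  have h1 : ∀ u v, (starGraph k).Adj u v → rank u < rank v := by
    rintro (_ | u) (_ | v) h
    · exact h.elim
    · exact h.elim
    · simp only [rank]
      split_ifs <;> omega
    · simp only [rank]
      rcases starGraph_adj_some.1 h with ⟨rfl, h2, h3, h4⟩ | ⟨rfl, rfl, h2, h3⟩
      · simp [h2, h4]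
      · simp [h2]
  have h2 : ∀ u v, Relation.TransGen (starGraph k).Adj u v → rank u < rank v := by
    intro u v h
    induction h with
    | single h => exact h1 _ _ h
    | tail _ h ih => exact ih.trans (h1 _ _ h)
  exact fun v h => lt_irrefl _ (h2 v v h)

theorem starGraph_adj_or_adj (k : Fin (m + 2)) (u v : Node (m + 2)) :
    ((starGraph k).Adj u v ∨ (starGraph k).Adj v u) ↔
      ((starGraph 0).Adj u v ∨ (starGraph 0).Adj v u) := by
  rcases u with _ | u <;> rcases v with _ | v
  · exact Iff.rfl
  · exact Iff.rfl
  · exact Iff.rfl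
  · simp only [starGraph_adj_some]
    by_cases h1 : u = k <;> by_cases h2 : v = k <;> by_cases h3 : u = 0 <;>
      by_cases h4 : v = 0 <;> simp_all

/-- A leaf has at most the hub as parent, and the hub at most `X_k`; so colliders with two distinct
parents occur only at `Y`. Since all variables point to `Y`, the v-structures are determined by the
skeleton. -/
theorem starGraph_isVStructure (k : Fin (m + 2)) (a b c : Node (m + 2)) :
    IsVStructure (starGraph k) a b c ↔
      c = none ∧ a ≠ none ∧ b ≠ none ∧ a ≠ b ∧
        ¬ ((starGraph k).Adj a b ∨ (starGraph k).Adj b a) := by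
  unfold IsVStructure
  rcases a with _ | a
  · simp [starGraph_not_adj]
  rcases b with _ | b
  · simp [starGraph_not_adj]
  rcases c with _ | c
  · simp [starGraph_adj_none]
  · simp only [reduceCtorEq, false_and, iff_false]
    rintro ⟨h1, h2, h3, -⟩
    rw [starGraph_adj_some] at h1 h2
    apply h3
    rcases h1 with ⟨h1, h4, -⟩ | ⟨h1, h4, -⟩ <;> rcases h2 with ⟨h2, h5, -⟩ | ⟨h2, h5, -⟩
    · rw [h1, h2]
    · exact absurd h2 h4
    · exact absurd h1 h5
    · rw [h4, h5]

theorem starGraph_markovEquivalent_iff (k : Fin (m + 2)) (H : Digraph (Node (m + 2))) :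
    MarkovEquivalent (starGraph k) H ↔ MarkovEquivalent (starGraph 0) H := by
  have h1 : (starGraph k).toSimpleGraphInclusive = (starGraph 0).toSimpleGraphInclusive := by
    ext u v
    simp only [Digraph.toSimpleGraphInclusive, SimpleGraph.fromRel_adj, starGraph_adj_or_adj k]
  have h2 : ∀ a b c, IsVStructure (starGraph k) a b c ↔ IsVStructure (starGraph 0) a b c := by
    intro a b c
    rw [starGraph_isVStructure, starGraph_isVStructure, starGraph_adj_or_adj k]
  unfold MarkovEquivalent
  simp only [h1, h2]

theorem essentialGraph_starGraph (k : Fin (m + 2)) :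
    essentialGraph (starGraph k) = essentialGraph (starGraph 0) := by
  unfold essentialGraph
  simp only [starGraph_markovEquivalent_iff k]

/-- The index 1 is excluded because `X_1` is not a leaf: `starGraph 1` reverses nothing and
coincides with `starGraph 0`. -/
theorem starGraph_injOn : Set.InjOn (starGraph (m := m)) {k | k ≠ 1} := by
  have key : ∀ k l : Fin (m + 2), k ≠ 1 → k ≠ 0 → starGraph k = starGraph l → k = l := by
    intro k l h1 h0 h
    have h2 : (starGraph k).Adj (some k) (some 0) :=
      starGraph_adj_some.2 (Or.inr ⟨rfl, rfl, h0, h1⟩)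
    rw [h, starGraph_adj_some] at h2
    rcases h2 with ⟨h2, -⟩ | ⟨-, h2, -⟩
    · exact absurd h2 h0
    · exact h2
  intro k hk l hl h
  by_cases h0 : k = 0
  · by_cases h1 : l = 0
    · rw [h0, h1]
    · exact (key l k hl h1 h.symm).symm
  · exact key k l hk h0 h

end Graph

/-! ### The models -/

/-- Parameters of the models: the probability `p` of a leaf to be `1`, the strength `η` of the
dependence between a leaf and the hub, and the mean reward `α` if `X_1 = 1`. -/
structure StarParams where
  p : ℝ
  η : ℝ
  α : ℝ
  p_pos : 0 < p
  p_le : p ≤ 1 / 2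
  η_nonneg : 0 ≤ η
  η_le : η ≤ 1 / 2
  half_le_α : 1 / 2 ≤ α
  α_lt_one : α < 1

/-- The probability that a Bernoulli variable with mean `q` has the value `b`. -/
def bern (q : ℝ) (b : Bool) : ℝ := if b = true then q else 1 - q

/-- `1` for `true` and `-1` for `false`. -/
def sign (b : Bool) : ℝ := if b = true then 1 else -1

theorem bern_pos {q : ℝ} (h0 : 0 < q) (h1 : q < 1) (b : Bool) : 0 < bern q b := by
  unfold bern
  split_ifs <;> linarith

theorem sum_bern (q : ℝ) : ∑ b, bern q b = 1 := by
  simp [bern]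

namespace StarParams

variable (S : StarParams) {m : ℕ}

/-- The probability that a leaf is `1`, given the value of the hub. -/
noncomputable def leafProb (c : Bool) : ℝ := S.p * (1 + S.η * sign c)

/-- The probability that the hub is `1`, given the value `d` of a leaf, is `(1 + tilt d) / 2`. -/
noncomputable def tilt (d : Bool) : ℝ := if d = true then S.η else -(S.p * S.η / (1 - S.p))

/-- The probability that the reward is `1`. -/
noncomputable def reward (z : Fin (m + 2) → Bool) : ℝ :=
  if z 1 = true then S.α
  else if z 0 = true ∧ ∃ i, i ≠ 0 ∧ i ≠ 1 ∧ z i = true then 3 / 4 else 1 / 4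

/-- The conditional probabilities of the model whose graph is `starGraph k`. -/
noncomputable def cpt (k : Fin (m + 2)) (v : Node (m + 2)) (x : Assignment (m + 2)) : ℝ :=
  match v with
  | none => S.reward fun i => x (some i)
  | some u =>
    if u = 1 then 1 / 2
    else if u = 0 then (if k = 0 ∨ k = 1 then 1 / 2 else (1 + S.tilt (x (some k))) / 2)
    else if u = k then S.p else S.leafProb (x (some 0))

theorem leafProb_pos (c : Bool) : 0 < S.leafProb c := by
  have := S.η_le
  have := S.η_nonneg
  refine mul_pos S.p_pos ?_
  cases c <;> simp [sign] <;> linarith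

theorem leafProb_le (c : Bool) : S.leafProb c ≤ 3 / 2 * S.p := by
  have := S.η_le
  have := S.η_nonneg
  rw [leafProb, mul_comm]
  refine mul_le_mul_of_nonneg_right ?_ S.p_pos.le
  cases c <;> simp [sign] <;> linarith

theorem leafProb_lt_one (c : Bool) : S.leafProb c < 1 := by
  have := S.leafProb_le c
  have := S.p_le
  linarith

theorem abs_tilt_le (d : Bool) : |S.tilt d| ≤ S.η := by
  have h1 := S.η_nonneg
  have h2 := S.p_le
  have h3 := S.p_pos
  cases d
  · simp only [tilt, Bool.false_eq_true, if_false, abs_neg]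
    rw [abs_of_nonneg (div_nonneg (by positivity) (by linarith)), div_le_iff₀ (by linarith)]
    nlinarith
  · simp [tilt, abs_of_nonneg h1]

theorem cpt_pos (k : Fin (m + 2)) (v : Node (m + 2)) (x : Assignment (m + 2)) :
    0 < S.cpt k v x := by
  have := S.half_le_α
  rcases v with _ | u
  · simp only [cpt, reward]
    split_ifs <;> linarith
  · have h2 := (abs_le.1 (S.abs_tilt_le (x (some k)))).1
    have h3 := S.η_le
    simp only [cpt]
    split_ifs
    · norm_num
    · norm_num
    · linarith
    · exact S.p_pos
    · exact S.leafProb_pos _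

theorem cpt_lt_one (k : Fin (m + 2)) (v : Node (m + 2)) (x : Assignment (m + 2)) :
    S.cpt k v x < 1 := by
  have := S.α_lt_one
  rcases v with _ | u
  · simp only [cpt, reward]
    split_ifs <;> linarith
  · have h2 := (abs_le.1 (S.abs_tilt_le (x (some k)))).2
    have h3 := S.η_le
    have h4 := S.p_le
    simp only [cpt]
    split_ifs
    · norm_num
    · norm_num
    · linarith
    · linarith
    · exact S.leafProb_lt_one _

/-- The model with the edge between the hub and `X_k` reversed. -/
noncomputable def model (k : Fin (m + 2)) : CausalModel (m + 2) where
  graph := starGraph k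
  isDAG := starGraph_isDAG k
  reward_sink := starGraph_not_adj k
  cpt := S.cpt k
  cpt_nonneg v x := (S.cpt_pos k v x).le
  cpt_le_one v x := (S.cpt_lt_one k v x).le
  cpt_parents v x x' h := by
    rcases v with _ | u
    · have h1 : ∀ i : Fin (m + 2), x (some i) = x' (some i) :=
        fun i => h _ (starGraph_adj_none k i)
      simp only [StarParams.cpt, h1]
    · simp only [StarParams.cpt]
      by_cases h1 : u = 1
      · simp [h1]
      by_cases h0 : u = 0
      · subst h0
        by_cases hk : k = 0 ∨ k = 1
        · simp [hk]
        · have hk' := not_or.1 hk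
          simp only [if_neg h1, if_true, if_neg hk]
          rw [h (some k) (starGraph_adj_some.2 (Or.inr ⟨rfl, rfl, hk'⟩))]
      by_cases huk : u = k
      · simp only [if_neg h1, if_neg h0, if_pos huk]
      · simp only [if_neg h1, if_neg h0, if_neg huk]
        rw [h (some 0) (starGraph_adj_some.2 (Or.inl ⟨rfl, h0, h1, huk⟩))]

theorem obsDist_pos (k : Fin (m + 2)) (x : Assignment (m + 2)) : 0 < (S.model k).obsDist x :=
  Finset.prod_pos fun v _ => bern_pos (S.cpt_pos k v x) (S.cpt_lt_one k v x) _

end StarParams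

/-- The factor of the node `v` in the truncated factorization. -/
noncomputable def CausalModel.doFactor {n : ℕ} {V : Finset (Fin n)} (M : CausalModel n)
    (a : Action V) (v : Node n) (x : Assignment n) : ℝ :=
  match a with
  | none => M.nodeProb v x
  | some (i, b) => if v = some i.1 then (if x v = b then 1 else 0) else M.nodeProb v x

theorem CausalModel.doDist_eq_prod {n : ℕ} {V : Finset (Fin n)} (M : CausalModel n)
    (a : Action V) (x : Assignment n) : M.doDist a x = ∏ v, M.doFactor a v x := by
  rcases a with _ | ⟨i, b⟩
  · rfl
  · simp only [CausalModel.doDist, CausalModel.doFactor]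
    rw [← Finset.mul_prod_erase _ _ (Finset.mem_univ (some i.1)), if_pos rfl, ite_mul, one_mul,
      zero_mul]
    congr 1
    refine Finset.prod_congr rfl fun v hv => ?_
    rw [if_neg (Finset.ne_of_mem_erase hv)]

theorem prod_eq_prod_mul_of_eq_off_pair {ι : Type} [Fintype ι] [DecidableEq ι] {f g : ι → ℝ}
    {a b : ι} (hab : a ≠ b) (h : ∀ v, v ≠ a → v ≠ b → f v = g v) {r : ℝ}
    (hr : f a * f b = g a * g b * r) : ∏ v, f v = (∏ v, g v) * r := by
  have hb : b ∈ Finset.univ.erase a := Finset.mem_erase.2 ⟨hab.symm, Finset.mem_univ b⟩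
  rw [← Finset.mul_prod_erase _ f (Finset.mem_univ a), ← Finset.mul_prod_erase _ f hb,
    ← Finset.mul_prod_erase _ g (Finset.mem_univ a), ← Finset.mul_prod_erase _ g hb,
    Finset.prod_congr (g := g) rfl fun v hv => h v
      (Finset.ne_of_mem_erase (Finset.mem_of_mem_erase hv)) (Finset.ne_of_mem_erase hv)]
  linear_combination (∏ v ∈ (Finset.univ.erase a).erase b, g v) * hr

/-! ### Likelihood ratio of a reversed edge -/

namespace StarParams

variable (S : StarParams) {m : ℕ} {V : Finset (Fin (m + 2))}

/-- The likelihood ratio between `S.model k` and `S.model 0`. -/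
noncomputable def ratio (k : Fin (m + 2)) (a : Action V) (z : Fin (m + 2) → Bool) : ℝ :=
  match a with
  | none => 1
  | some (i, b) =>
    if i.1 = k then 1 + sign (z 0) * S.tilt b
    else if i.1 = 0 then bern S.p (z k) / bern (S.leafProb b) (z k)
    else 1

theorem ratio_pos (k : Fin (m + 2)) (a : Action V) (z : Fin (m + 2) → Bool) :
    0 < S.ratio k a z := by
  rcases a with _ | ⟨i, b⟩
  · exact one_pos
  · simp only [ratio]
    have h1 := S.p_le
    split_ifs
    · have h2 := abs_le.1 (S.abs_tilt_le b)
      have h3 := S.η_le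
      cases z 0 <;> simp [sign] <;> linarith
    · exact div_pos (bern_pos S.p_pos (by linarith) _)
        (bern_pos (S.leafProb_pos _) (S.leafProb_lt_one _) _)
    · exact one_pos

/-- Bayes' rule for the pair (hub, leaf); `tilt` is defined so that both factorizations give the
same joint law. -/
theorem hub_mul_leaf (c d : Bool) : bern ((1 + S.tilt d) / 2) c * bern S.p d =
    bern (1 / 2) c * bern (S.leafProb c) d := by
  have h1 : (1 - S.p) ≠ 0 := by
    have := S.p_le
    intro h
    linarith
  cases c <;> cases d <;> simp [bern, tilt, leafProb, sign] <;> field_simp <;> ring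

theorem hub_eq (c d : Bool) :
    bern ((1 + S.tilt d) / 2) c = bern (1 / 2) c * (1 + sign c * S.tilt d) := by
  cases c <;> simp [bern, sign] <;> ring

/-- Only the factors of the hub and of `X_k` differ. If neither is intervened on, their products
agree by `hub_mul_leaf`; if one is, its factor is replaced by an indicator and the other leaves the
ratio. -/
theorem doDist_model {k : Fin (m + 2)} (h0 : k ≠ 0) (h1 : k ≠ 1) (a : Action V)
    (x : Assignment (m + 2)) : (S.model k).doDist a x =
      (S.model 0).doDist a x * S.ratio k a fun i => x (some i) := by
  rw [CausalModel.doDist_eq_prod, CausalModel.doDist_eq_prod]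
  have hk : ∀ l : Fin (m + 2), (S.model l).nodeProb (some k) x =
      if k = l then bern S.p (x (some k)) else bern (S.leafProb (x (some 0))) (x (some k)) := by
    intro l
    simp only [CausalModel.nodeProb, model, cpt, if_neg h0, if_neg h1, bern]
    split_ifs <;> rfl
  have hhub0 : (S.model 0).nodeProb (some (0 : Fin (m + 2))) x = bern (1 / 2) (x (some 0)) := by
    simp [CausalModel.nodeProb, model, cpt, bern]
  have hhubk : (S.model k).nodeProb (some (0 : Fin (m + 2))) x =
      bern ((1 + S.tilt (x (some k))) / 2) (x (some 0)) := by
    simp [CausalModel.nodeProb, model, cpt, bern, h0, h1]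
  have hother : ∀ v : Node (m + 2), v ≠ some 0 → v ≠ some k →
      (S.model k).nodeProb v x = (S.model 0).nodeProb v x := by
    rintro (_ | u) hu0 huk
    · rfl
    · simp only [ne_eq, Option.some.injEq] at hu0 huk
      simp [CausalModel.nodeProb, model, cpt, hu0, huk]
  have h0k : (some (0 : Fin (m + 2))) ≠ some k := fun h => h0 (Option.some.inj h).symm
  refine prod_eq_prod_mul_of_eq_off_pair h0k ?_ ?_
  · intro v hv0 hvk
    rcases a with _ | ⟨i, b⟩
    · exact hother v hv0 hvk
    · simp only [CausalModel.doFactor]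
      rw [hother v hv0 hvk]
  · rcases a with _ | ⟨⟨i, hi⟩, b⟩
    · simp only [CausalModel.doFactor, ratio, mul_one]
      rw [hk, hk, if_pos rfl, if_neg h0, hhub0, hhubk, hub_mul_leaf]
    · simp only [CausalModel.doFactor, ratio, Option.some.injEq]
      by_cases hik : i = k
      · subst hik
        rw [if_pos rfl, if_neg (Ne.symm h0), if_pos rfl, hhub0, hhubk, if_neg (Ne.symm h0), hub_eq]
        by_cases hb : x (some i) = b
        · rw [if_pos hb, if_pos rfl, hb]
          ring
        · rw [if_neg hb]
          ring
      · rw [if_neg (Ne.symm hik), if_neg (Ne.symm hik), if_neg hik]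
        by_cases hi0 : i = 0
        · subst hi0
          rw [if_pos rfl, if_pos rfl, hk, hk, if_pos rfl, if_neg h0]
          by_cases hb : x (some 0) = b
          · rw [if_pos hb, if_pos rfl, hb]
            have := bern_pos (S.leafProb_pos b) (S.leafProb_lt_one b) (x (some k))
            field_simp
          · rw [if_neg hb]
            ring
        · rw [if_neg (Ne.symm hi0), if_neg (Ne.symm hi0), if_neg hi0, hk, hk, if_pos rfl,
            if_neg h0, hhub0, hhubk, hub_mul_leaf, mul_one]

theorem obsDist_model {k : Fin (m + 2)} (h1 : k ≠ 1) :
    (S.model k).obsDist = (S.model 0).obsDist := by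
  by_cases h0 : k = 0
  · rw [h0]
  · funext x
    have h := S.doDist_model h0 h1 (none : Action (∅ : Finset (Fin (m + 2)))) x
    simpa [CausalModel.doDist, ratio] using h

/-! ### Expectations in the star with all edges leaving the hub -/

/-- The mean of `X_u`, given the value of the hub. -/
noncomputable def starMean (u : Fin (m + 2)) (c : Bool) : ℝ :=
  if u = 0 ∨ u = 1 then 1 / 2 else S.leafProb c

/-- The law of `X_u` under `a`, given the value of the hub. -/
noncomputable def starKernel (a : Action V) (u : Fin (m + 2)) (c d : Bool) : ℝ :=
  match a with
  | none => bern (S.starMean u c) d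
  | some (i, b) => if u = i.1 then (if d = b then 1 else 0) else bern (S.starMean u c) d

/-- The expectation of `F (X_0, X_1, …)` under `a`. -/
noncomputable def starExp (a : Action V) (F : (Fin (m + 2) → Bool) → ℝ) : ℝ :=
  ∑ z, (∏ u, S.starKernel a u (z 0) (z u)) * F z

theorem starKernel_nonneg (a : Action V) (u : Fin (m + 2)) (c d : Bool) :
    0 ≤ S.starKernel a u c d := by
  have h : 0 ≤ bern (S.starMean u c) d := by
    refine (bern_pos ?_ ?_ d).le <;> unfold starMean <;> split_ifs
    · norm_num
    · exact S.leafProb_pos c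
    · norm_num
    · exact S.leafProb_lt_one c
  rcases a with _ | ⟨i, b⟩
  · exact h
  · simp only [starKernel]
    split_ifs
    · exact zero_le_one
    · exact le_rfl
    · exact h

theorem sum_starKernel (a : Action V) (u : Fin (m + 2)) (c : Bool) :
    ∑ d, S.starKernel a u c d = 1 := by
  rcases a with _ | ⟨i, b⟩
  · exact sum_bern _
  · simp only [starKernel]
    split_ifs
    · simp
    · exact sum_bern _

theorem doDist_model_zero (a : Action V) (x : Assignment (m + 2)) : (S.model 0).doDist a x =
    bern (S.reward fun i => x (some i)) (x none) *
      ∏ u, S.starKernel a u (x (some 0)) (x (some u)) := by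
  rw [CausalModel.doDist_eq_prod, Fintype.prod_option]
  have h : ∀ u, (S.model 0).nodeProb (some u) x =
      bern (S.starMean u (x (some 0))) (x (some u)) := by
    intro u
    by_cases h0 : u = 0
    · simp [CausalModel.nodeProb, model, cpt, starMean, bern, h0]
    · by_cases h1 : u = 1 <;>
        simp [CausalModel.nodeProb, model, cpt, starMean, bern, h0, h1]
  congr 1
  · rcases a with _ | ⟨i, b⟩
    · rfl
    · simp [CausalModel.doFactor, CausalModel.nodeProb, model, cpt, bern]
  · refine Finset.prod_congr rfl fun u _ => ?_
    rcases a with _ | ⟨i, b⟩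
    · exact h u
    · simp only [CausalModel.doFactor, starKernel, h, Option.some.injEq]

theorem sum_doDist_model_zero_mul (a : Action V) (F : Bool → (Fin (m + 2) → Bool) → ℝ) :
    ∑ x, (S.model 0).doDist a x * F (x none) (fun i => x (some i)) =
      S.starExp a fun z => ∑ y, bern (S.reward z) y * F y z := by
  simp_rw [S.doDist_model_zero]
  rw [← (Equiv.piOptionEquivProd (β := fun _ : Node (m + 2) => Bool)).symm.sum_comp,
    Fintype.sum_prod_type, Finset.sum_comm, starExp]
  refine Finset.sum_congr rfl fun z _ => ?_
  rw [Finset.mul_sum]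
  refine Finset.sum_congr rfl fun y _ => ?_
  simp only [Equiv.piOptionEquivProd_symm_apply]
  ring

theorem sum_doDist_mul (a : Action V) (F : (Fin (m + 2) → Bool) → ℝ) :
    ∑ x, (S.model 0).doDist a x * F (fun i => x (some i)) = S.starExp a F := by
  rw [S.sum_doDist_model_zero_mul a fun _ => F]
  simp_rw [← Finset.sum_mul, sum_bern, one_mul]

theorem mean_model_zero (a : Action V) : (S.model 0).mean a = S.starExp a S.reward := by
  have h := S.sum_doDist_model_zero_mul a fun y _ => if y = true then (1 : ℝ) else 0
  rw [CausalModel.mean, h]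
  simp [bern]

theorem mean_model {k : Fin (m + 2)} (h0 : k ≠ 0) (h1 : k ≠ 1) (a : Action V) :
    (S.model k).mean a = S.starExp a fun z => S.ratio k a z * S.reward z := by
  have h := S.sum_doDist_model_zero_mul a fun y z =>
    S.ratio k a z * if y = true then (1 : ℝ) else 0
  simp_rw [CausalModel.mean, S.doDist_model h0 h1, mul_assoc, h]
  simp [bern, mul_comm]

/-- The law under `do(X_i = b)` gives no mass to assignments with another value of `X_i`. -/
theorem starExp_congr {a : Action V} {F G : (Fin (m + 2) → Bool) → ℝ}
    (h : ∀ z, (∀ i b, a = some (i, b) → z i.1 = b) → F z = G z) :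
    S.starExp a F = S.starExp a G := by
  refine Finset.sum_congr rfl fun z _ => ?_
  by_cases hz : ∀ i b, a = some (i, b) → z i.1 = b
  · rw [h z hz]
  · push Not at hz
    obtain ⟨i, b, rfl, hz⟩ := hz
    rw [Finset.prod_eq_zero (Finset.mem_univ i.1), zero_mul, zero_mul]
    simp [starKernel, hz]

theorem starExp_mono {a : Action V} {F G : (Fin (m + 2) → Bool) → ℝ} (h : ∀ z, F z ≤ G z) :
    S.starExp a F ≤ S.starExp a G :=
  Finset.sum_le_sum fun z _ => mul_le_mul_of_nonneg_left (h z)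
    (Finset.prod_nonneg fun _ _ => S.starKernel_nonneg _ _ _ _)

theorem starExp_add (a : Action V) (F G : (Fin (m + 2) → Bool) → ℝ) :
    S.starExp a (fun z => F z + G z) = S.starExp a F + S.starExp a G := by
  simp only [starExp, mul_add, Finset.sum_add_distrib]

theorem starExp_sum {ι : Type} (s : Finset ι) (a : Action V)
    (F : ι → (Fin (m + 2) → Bool) → ℝ) :
    S.starExp a (fun z => ∑ i ∈ s, F i z) = ∑ i ∈ s, S.starExp a (F i) := by
  simp only [starExp, Finset.mul_sum]
  exact Finset.sum_comm

/-- Given the hub, the other variables are independent under every action, so expectations of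
products factor conditionally on the hub. -/
theorem starExp_prod (a : Action V) (φ : Fin (m + 2) → Bool → Bool → ℝ) :
    S.starExp a (fun z => ∏ u, φ u (z 0) (z u)) = ∑ c, S.starKernel a 0 c c * φ 0 c c *
      ∏ u ∈ Finset.univ.erase 0, ∑ d, S.starKernel a u c d * φ u c d := by
  have h : ∀ c, S.starKernel a 0 c c * φ 0 c c *
      ∏ u ∈ Finset.univ.erase 0, ∑ d, S.starKernel a u c d * φ u c d =
      ∑ z : Fin (m + 2) → Bool, if z 0 = c then
        (∏ u, S.starKernel a u (z 0) (z u)) * ∏ u, φ u (z 0) (z u) else 0 := by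
    intro c
    -- The additional indicator pins the hub's coordinate to `c`, so that the whole expression
    -- becomes a product of sums over all coordinates.
    calc _ = ∏ u, ∑ d, S.starKernel a u c d * φ u c d *
          (if u = 0 then (if d = c then 1 else 0) else 1) := by
          rw [← Finset.mul_prod_erase _ _ (Finset.mem_univ (0 : Fin (m + 2)))]
          congr 1
          · simp
          · refine Finset.prod_congr rfl fun u hu => ?_
            simp [Finset.ne_of_mem_erase hu]
      _ = _ := by
          rw [Fintype.prod_sum]
          refine Finset.sum_congr rfl fun z _ => ?_
          rw [Finset.prod_mul_distrib, Finset.prod_mul_distrib, Fintype.prod_ite_eq']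
          split_ifs with hz
          · rw [hz, mul_one]
          · rw [mul_zero]
  simp_rw [h]
  rw [Finset.sum_comm, starExp]
  simp

theorem starExp_one_coord (a : Action V) {u : Fin (m + 2)} (hu : u ≠ 0) (F : Bool → Bool → ℝ) :
    S.starExp a (fun z => F (z 0) (z u)) =
      ∑ c, S.starKernel a 0 c c * ∑ d, S.starKernel a u c d * F c d := by
  have h := S.starExp_prod a fun w c d => if w = u then F c d else 1
  simp only [Fintype.prod_ite_eq'] at h
  rw [h]
  refine Finset.sum_congr rfl fun c _ => ?_
  rw [if_neg (Ne.symm hu), mul_one, Finset.prod_eq_single u]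
  · simp
  · intro w _ hw
    simp [hw, sum_starKernel, -Fintype.univ_bool]
  · intro h
    exact absurd (Finset.mem_erase.2 ⟨hu, Finset.mem_univ u⟩) h

theorem starExp_two_coords (a : Action V) {u v : Fin (m + 2)} (hu : u ≠ 0) (hv : v ≠ 0)
    (huv : u ≠ v) (F G : Bool → ℝ) :
    S.starExp a (fun z => F (z u) * G (z v)) =
      ∑ c, S.starKernel a 0 c c *
        ((∑ d, S.starKernel a u c d * F d) * ∑ d, S.starKernel a v c d * G d) := by
  have h := S.starExp_prod a fun w _ d => (if w = u then F d else 1) * (if w = v then G d else 1)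
  simp only [Finset.prod_mul_distrib, Fintype.prod_ite_eq'] at h
  rw [h]
  refine Finset.sum_congr rfl fun c _ => ?_
  rw [if_neg (Ne.symm hu), if_neg (Ne.symm hv), mul_one, mul_one,
    ← Finset.mul_prod_erase _ _ (Finset.mem_erase.2 ⟨hu, Finset.mem_univ u⟩),
    Finset.prod_eq_single v]
  · simp [huv, Ne.symm huv]
  · intro w hw hwv
    simp [Finset.ne_of_mem_erase hw, hwv, sum_starKernel, -Fintype.univ_bool]
  · intro h
    exact absurd (Finset.mem_erase.2 ⟨Ne.symm huv, Finset.mem_erase.2 ⟨hv, Finset.mem_univ v⟩⟩) h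

end StarParams

/-! ### Marginal laws under interventions and normalization -/

namespace StarParams

variable (S : StarParams) {m : ℕ} {V : Finset (Fin (m + 2))}

theorem starKernel_hub (a : Action V) (ha : ∀ i b, a = some (i, b) → i.1 ≠ 0) (c : Bool) :
    S.starKernel a 0 c c = 1 / 2 := by
  have h : bern (S.starMean (0 : Fin (m + 2)) c) c = 1 / 2 := by
    cases c <;> norm_num [bern, starMean]
  rcases a with _ | ⟨i, b⟩
  · exact h
  · simp only [starKernel, if_neg (Ne.symm (ha i b rfl)), h]

theorem starKernel_leaf {a : Action V} {k : Fin (m + 2)} (h0 : k ≠ 0) (h1 : k ≠ 1)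
    (ha : ∀ i b, a = some (i, b) → i.1 ≠ k) (c d : Bool) :
    S.starKernel a k c d = bern (S.leafProb c) d := by
  rcases a with _ | ⟨i, b⟩
  · simp [starKernel, starMean, h0, h1]
  · simp [starKernel, starMean, h0, h1, Ne.symm (ha i b rfl)]

theorem sum_starKernel_hub (a : Action V) : ∑ c, S.starKernel a 0 c c = 1 := by
  by_cases ha : ∀ i b, a = some (i, b) → i.1 ≠ 0
  · simp_rw [S.starKernel_hub a ha]
    norm_num
  · push Not at ha
    obtain ⟨i, b, rfl, hi⟩ := ha
    simp only [starKernel, if_pos hi.symm]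
    simp

/-- Under an intervention on a variable other than the hub, the hub is a fair coin. -/
theorem starExp_hub (a : Action V) (ha : ∀ i b, a = some (i, b) → i.1 ≠ 0) (F : Bool → ℝ) :
    S.starExp a (fun z => F (z 0)) = (F true + F false) / 2 := by
  rw [S.starExp_one_coord a (u := 1) Fin.zero_ne_one.symm fun c _ => F c]
  simp_rw [← Finset.sum_mul, sum_starKernel, S.starKernel_hub a ha]
  rw [Fintype.sum_bool]
  ring

theorem starExp_leaf_of_hub {k : Fin (m + 2)} (h0 : k ≠ 0) (h1 : k ≠ 1) (i : {i // i ∈ V})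
    (hi : i.1 = 0) (b : Bool) (F : Bool → ℝ) :
    S.starExp (some (i, b)) (fun z => F (z k)) = ∑ d, bern (S.leafProb b) d * F d := by
  rw [S.starExp_one_coord _ h0 fun _ d => F d]
  have h2 : ∀ i' b', (some (i, b) : Action V) = some (i', b') → i'.1 ≠ k := by
    rintro i' b' h
    simp only [Option.some.injEq, Prod.mk.injEq] at h
    rw [← h.1, hi]
    exact Ne.symm h0
  simp_rw [S.starKernel_leaf h0 h1 h2]
  rw [Finset.sum_eq_single b]
  · simp [starKernel, hi]
  · intro c _ hc
    simp [starKernel, hi, hc]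
  · simp

theorem starExp_const (a : Action V) (c : ℝ) : S.starExp a (fun _ => c) = c := by
  rw [S.starExp_one_coord a (u := 1) Fin.zero_ne_one.symm fun _ _ => c]
  simp_rw [← Finset.sum_mul, sum_starKernel, one_mul, ← Finset.sum_mul, sum_starKernel_hub,
    one_mul]

theorem starExp_ratio {k : Fin (m + 2)} (h0 : k ≠ 0) (h1 : k ≠ 1) (a : Action V) :
    S.starExp a (S.ratio k a) = 1 := by
  rcases a with _ | ⟨i, b⟩
  · exact S.starExp_const _ 1
  · unfold ratio
    dsimp only
    by_cases hik : i.1 = k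
    · simp only [if_pos hik]
      rw [S.starExp_hub _ _ fun c => 1 + sign c * S.tilt b]
      · simp only [sign, if_true, Bool.false_eq_true, if_false]
        ring
      · intro i' b' h
        simp only [Option.some.injEq, Prod.mk.injEq] at h
        rw [← h.1, hik]
        exact h0
    · by_cases hi0 : i.1 = 0
      · simp only [if_neg hik, if_pos hi0]
        rw [S.starExp_leaf_of_hub h0 h1 i hi0 b fun d => bern S.p d / bern (S.leafProb b) d,
          ← sum_bern S.p]
        refine Finset.sum_congr rfl fun d _ => ?_
        rw [mul_div_cancel₀]
        exact (bern_pos (S.leafProb_pos b) (S.leafProb_lt_one b) d).ne'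
      · simp only [if_neg hik, if_neg hi0]
        exact S.starExp_const _ 1

theorem isNormalized_model {k : Fin (m + 2)} (h1 : k ≠ 1) : IsNormalized V (S.model k) := by
  intro a
  by_cases h0 : k = 0
  · subst h0
    have h := S.sum_doDist_mul a fun _ => 1
    simpa only [mul_one, starExp_const] using h
  · simp_rw [S.doDist_model h0 h1]
    rw [S.sum_doDist_mul a (S.ratio k a), S.starExp_ratio h0 h1]

/-! ### Information about the reversed edge -/

/-- An upper bound for the divergence between `S.model 0` and `S.model k` under `a`. -/
noncomputable def infoBound (k : Fin (m + 2)) (a : Action V) : ℝ :=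
  match a with
  | none => 0
  | some (i, _) => if i.1 = k then 2 * S.η ^ 2 else if i.1 = 0 then 2 * S.p * S.η ^ 2 else 0

theorem sum_inv_one_add_sign_mul_le {t e : ℝ} (ht : |t| ≤ e) (he : e ≤ 1 / 2) :
    ((1 / (1 + sign true * t) - 1) + (1 / (1 + sign false * t) - 1)) / 2 ≤ 2 * e ^ 2 := by
  have h1 : t ^ 2 ≤ e ^ 2 := sq_le_sq' (abs_le.1 ht).1 (abs_le.1 ht).2
  have h2 := abs_le.1 ht
  have h3 : 0 ≤ e := (abs_nonneg t).trans ht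
  have h4 : 0 < 1 + t := by linarith
  have h5 : 0 < 1 - t := by linarith
  have h6 : ((1 / (1 + sign true * t) - 1) + (1 / (1 + sign false * t) - 1)) / 2 =
      t ^ 2 / ((1 + t) * (1 - t)) := by
    simp only [sign, if_true, one_mul, Bool.false_eq_true, if_false, neg_one_mul]
    rw [← sub_eq_add_neg]
    field_simp
    ring
  rw [h6, div_le_iff₀ (mul_pos h4 h5)]
  have h7 : e ^ 2 ≤ 1 / 4 := by nlinarith
  nlinarith [sq_nonneg t]

/-- The chi-square divergence between Bernoulli laws with means `p (1 ± η)` and `p` is `p η² / (1 -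
p)`. The factor `p` is what makes interventions on the hub uninformative about a single leaf. -/
theorem chiSq_leaf_le (b : Bool) :
    ∑ d, bern (S.leafProb b) d * (bern (S.leafProb b) d / bern S.p d - 1) ≤
      2 * S.p * S.η ^ 2 := by
  have h1 := S.p_pos
  have h2 := S.p_le
  have h3 : 0 < 1 - S.p := by linarith
  have h4 : ∑ d, bern (S.leafProb b) d * (bern (S.leafProb b) d / bern S.p d - 1) =
      S.p * S.η ^ 2 / (1 - S.p) := by
    rw [Fintype.sum_bool]
    cases b <;> simp only [bern, leafProb, sign, if_true, Bool.false_eq_true, if_false] <;>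
      field_simp <;> ring
  rw [h4, div_le_iff₀ h3]
  nlinarith [mul_nonneg h1.le (sq_nonneg S.η)]

/-- The Kullback–Leibler divergence is at most the chi-square divergence, by `log t ≤ t - 1` at the
inverse ratio; the latter is explicit for each kind of action. -/
theorem sum_doDist_mul_neg_log_ratio_le {k : Fin (m + 2)} (h0 : k ≠ 0) (h1 : k ≠ 1)
    (a : Action V) :
    ∑ x, (S.model 0).doDist a x * (-Real.log (S.ratio k a fun i => x (some i))) ≤
      S.infoBound k a := by
  rw [S.sum_doDist_mul a fun z => -Real.log (S.ratio k a z)]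
  have h2 : S.starExp a (fun z => -Real.log (S.ratio k a z)) ≤
      S.starExp a fun z => 1 / S.ratio k a z - 1 := by
    refine S.starExp_mono fun z => ?_
    rw [← Real.log_inv, one_div]
    exact Real.log_le_sub_one_of_pos (inv_pos.2 (S.ratio_pos k a z))
  refine h2.trans ?_
  rcases a with _ | ⟨i, b⟩
  · simp only [ratio, infoBound]
    rw [S.starExp_const]
    norm_num
  · simp only [ratio, infoBound]
    by_cases hik : i.1 = k
    · simp only [if_pos hik]
      rw [S.starExp_hub _ _ fun c => 1 / (1 + sign c * S.tilt b) - 1]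
      · exact sum_inv_one_add_sign_mul_le (S.abs_tilt_le b) S.η_le
      · intro i' b' h
        simp only [Option.some.injEq, Prod.mk.injEq] at h
        rw [← h.1, hik]
        exact h0
    · by_cases hi0 : i.1 = 0
      · simp only [if_neg hik, if_pos hi0, one_div_div]
        rw [S.starExp_leaf_of_hub h0 h1 i hi0 b fun d => bern (S.leafProb b) d / bern S.p d - 1]
        exact S.chiSq_leaf_le b
      · simp only [if_neg hik, if_neg hi0]
        rw [S.starExp_const]
        norm_num

/-- The leaves of the star. -/
def leaves (m : ℕ) : Finset (Fin (m + 2)) := (Finset.univ.erase 0).erase 1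

theorem mem_leaves {k : Fin (m + 2)} : k ∈ leaves m ↔ k ≠ 0 ∧ k ≠ 1 := by
  simp [leaves, and_comm]

theorem card_leaves (m : ℕ) : (leaves m).card = m := by
  rw [leaves, Finset.card_erase_of_mem (by simp), Finset.card_erase_of_mem (by simp)]
  simp

/-- No action is informative about many leaves. -/
theorem sum_infoBound_le (hp : m * S.p ≤ 1) (a : Action V) :
    ∑ k ∈ leaves m, S.infoBound k a ≤ 2 * S.η ^ 2 := by
  have h1 := sq_nonneg S.η
  rcases a with _ | ⟨i, b⟩
  · simp only [infoBound, Finset.sum_const_zero]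
    positivity
  · simp only [infoBound]
    by_cases hi0 : i.1 = 0
    · rw [Finset.sum_congr (g := fun _ => 2 * S.p * S.η ^ 2) rfl, Finset.sum_const, card_leaves,
        nsmul_eq_mul]
      · nlinarith
      · intro k hk
        rw [if_neg, if_pos hi0]
        rw [hi0]
        exact Ne.symm (mem_leaves.1 hk).1
    · simp only [if_neg hi0]
      rw [Finset.sum_ite_eq]
      split_ifs
      · exact le_rfl
      · positivity

/-! ### Mean rewards -/

theorem reward_of_bonus {z : Fin (m + 2) → Bool} (h : z 1 = true) : S.reward z = S.α := by
  simp [reward, h]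

theorem mean_bonus {k : Fin (m + 2)} (h1 : k ≠ 1) (i : {i // i ∈ V}) (hi : i.1 = 1) :
    (S.model k).mean (some (i, true)) = S.α := by
  have key : S.starExp (some (i, true)) S.reward = S.α := by
    rw [← S.starExp_const (some (i, true)) S.α]
    refine S.starExp_congr fun z hz => S.reward_of_bonus ?_
    rw [← hi]
    exact hz i true rfl
  by_cases h0 : k = 0
  · rw [h0, mean_model_zero, key]
  · rw [S.mean_model h0 h1, ← key]
    congr 1
    funext z
    have h2 : i.1 ≠ k := fun h => h1 (h.symm.trans hi)
    have h3 : i.1 ≠ 0 := fun h => Fin.zero_ne_one (h.symm.trans hi)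
    simp [ratio, h2, h3]

theorem starExp_bonus (a : Action V) (F : Bool → ℝ) :
    S.starExp a (fun z => F (z 1)) = ∑ d, S.starKernel a 1 true d * F d := by
  have h : ∀ c d, S.starKernel a (1 : Fin (m + 2)) c d = S.starKernel a 1 true d := by
    intro c d
    rcases a with _ | ⟨i, b⟩ <;> simp [starKernel, starMean]
  rw [S.starExp_one_coord a (u := 1) Fin.zero_ne_one.symm fun _ d => F d]
  simp_rw [h _ _]
  rw [← Finset.sum_mul, sum_starKernel_hub, one_mul]

/-- Forcing the parent `X_k` to 1 both meets the leaf condition in the reward and makes the hub 1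
with probability `(1 + η) / 2`. The gain `η / 8` is the reward jump `1/2` times the probability
`1/2` of `X_1 = 0` times the tilt `η / 2`. -/
theorem mean_reversed {k : Fin (m + 2)} (h0 : k ≠ 0) (h1 : k ≠ 1) (i : {i // i ∈ V})
    (hi : i.1 = k) :
    (S.model k).mean (some (i, true)) = S.α / 2 + 1 / 4 + S.η / 8 := by
  rw [S.mean_model h0 h1, S.starExp_congr (G := fun z => (1 + sign (z 0) * S.η) *
    if z 1 = true then S.α else if z 0 = true then 3 / 4 else 1 / 4),
    S.starExp_one_coord _ (u := 1) Fin.zero_ne_one.symm fun c d => (1 + sign c * S.η) *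
      if d = true then S.α else if c = true then 3 / 4 else 1 / 4]
  · have h2 : ∀ c, S.starKernel (some (i, true)) 0 c c = 1 / 2 := by
      refine S.starKernel_hub _ ?_
      intro i' b' h
      simp only [Option.some.injEq, Prod.mk.injEq] at h
      rw [← h.1, hi]
      exact h0
    have h3 : ∀ c d, S.starKernel (some (i, true)) 1 c d = 1 / 2 := by
      intro c d
      have : (1 : Fin (m + 2)) ≠ i.1 := hi ▸ Ne.symm h1
      cases d <;> norm_num [starKernel, starMean, this, bern]
    simp_rw [h2, h3]
    simp only [Fintype.sum_bool, sign, if_true, Bool.false_eq_true, if_false]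
    ring
  · intro z hz
    have hzk : z k = true := hi ▸ hz i true rfl
    have h2 : ∃ i, i ≠ 0 ∧ i ≠ 1 ∧ z i = true := ⟨k, h0, h1, hzk⟩
    simp [ratio, hi, tilt, reward, h2]

theorem starKernel_bonus (a : Action V) (ha : ∀ i b, a = some (i, b) → i.1 ≠ 1) (c d : Bool) :
    S.starKernel a 1 c d = 1 / 2 := by
  have h : bern (S.starMean (1 : Fin (m + 2)) c) d = 1 / 2 := by
    cases d <;> norm_num [bern, starMean]
  rcases a with _ | ⟨i, b⟩
  · exact h
  · simp only [starKernel, if_neg (Ne.symm (ha i b rfl)), h]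

/-- When `X_1 = 0`, the reward is at most what it would be with some leaf equal to 1, and the hub,
having no parents here, stays a fair coin. -/
theorem mean_model_zero_le_of_leaf {k : Fin (m + 2)} (h0 : k ≠ 0) (h1 : k ≠ 1)
    (i : {i // i ∈ V}) (hi : i.1 = k) (b : Bool) :
    (S.model 0).mean (some (i, b)) ≤ S.α / 2 + 1 / 4 := by
  have h2 : S.starExp (some (i, b)) S.reward ≤ S.starExp (some (i, b)) fun z =>
      if z 1 = true then S.α else if z 0 = true then 3 / 4 else 1 / 4 := by
    refine S.starExp_mono fun z => ?_
    unfold reward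
    split_ifs <;> first | linarith | simp_all
  rw [mean_model_zero]
  refine h2.trans_eq ?_
  have h3 : ∀ i' b', (some (i, b) : Action V) = some (i', b') → i'.1 = k := by
    intro i' b' h
    simp only [Option.some.injEq, Prod.mk.injEq] at h
    rw [← h.1, hi]
  rw [S.starExp_one_coord _ (u := 1) Fin.zero_ne_one.symm fun c d =>
    if d = true then S.α else if c = true then 3 / 4 else 1 / 4]
  simp_rw [S.starKernel_hub _ fun i' b' h => (h3 i' b' h).trans_ne h0,
    S.starKernel_bonus _ fun i' b' h => (h3 i' b' h).trans_ne h1]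
  simp only [Fintype.sum_bool, if_true, Bool.false_eq_true, if_false]
  ring

/-- Without an intervention that sets a leaf to `1`, it is likely that all leaves are `0`. -/
theorem mean_model_zero_le_of_not_leaf (hp : (m : ℝ) * S.p ≤ 1 / 8) (a : Action V)
    (ha : ∀ i b, a = some (i, b) → i.1 = 0 ∨ i.1 = 1) :
    (S.model 0).mean a ≤ S.starKernel a 1 true true * S.α +
      S.starKernel a 1 true false * (1 / 2) := by
  -- Union bound: each leaf equal to 1 is charged the whole jump `3/4 - 1/4` of the reward.
  have h1 : S.starExp a S.reward ≤ S.starExp a fun z => (if z 1 = true then S.α else 1 / 4) +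
      ∑ k ∈ leaves m, (if z 1 = true then 0 else 1 / 2) * (if z k = true then 1 else 0) := by
    refine S.starExp_mono fun z => ?_
    have h0 : ∀ k ∈ leaves m,
        0 ≤ (if z 1 = true then (0 : ℝ) else 1 / 2) * (if z k = true then 1 else 0) := by
      intro k _
      split_ifs <;> norm_num
    unfold reward
    by_cases hz : z 1 = true
    · simp [hz]
    · simp only [if_neg hz] at h0 ⊢
      split_ifs with h
      · obtain ⟨-, k, hk0, hk1, hk⟩ := h
        have h2 := Finset.single_le_sum h0 (mem_leaves.2 ⟨hk0, hk1⟩)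
        rw [if_pos hk] at h2
        linarith
      · linarith [Finset.sum_nonneg h0]
  rw [mean_model_zero]
  refine h1.trans ?_
  rw [starExp_add, starExp_sum, S.starExp_bonus a fun d => if d = true then S.α else 1 / 4]
  have h2 : ∀ c d, S.starKernel a (1 : Fin (m + 2)) c d = S.starKernel a 1 true d := by
    intro c d
    rcases a with _ | ⟨i, b⟩ <;> simp [starKernel, starMean]
  set w := S.starKernel a (1 : Fin (m + 2)) true false with hw
  have hw0 : 0 ≤ w := S.starKernel_nonneg _ _ _ _
  have h3 : ∀ k ∈ leaves m, S.starExp a (fun z =>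
      (if z 1 = true then 0 else 1 / 2) * (if z k = true then 1 else 0)) ≤ w * S.p := by
    intro k hk
    obtain ⟨hk0, hk1⟩ := mem_leaves.1 hk
    rw [S.starExp_two_coords a Fin.zero_ne_one.symm hk0 (Ne.symm hk1)
      (fun d => if d = true then 0 else 1 / 2) fun d => if d = true then 1 else 0]
    calc _ ≤ ∑ c, S.starKernel a 0 c c * (w * S.p) := by
          refine Finset.sum_le_sum fun c _ => ?_
          refine mul_le_mul_of_nonneg_left ?_ (S.starKernel_nonneg _ _ _ _)
          simp_rw [h2 c]
          have ha' : ∀ i b, a = some (i, b) → i.1 ≠ k := by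
            rintro i b h rfl
            rcases ha i b h with h | h
            · exact hk0 h
            · exact hk1 h
          simp_rw [S.starKernel_leaf hk0 hk1 ha']
          simp only [Fintype.sum_bool, if_true, Bool.false_eq_true, if_false, bern]
          rw [← hw]
          -- The charge per leaf is at most `1/2 * (3/2 * p) ≤ p`.
          have := S.leafProb_le c
          nlinarith [S.p_pos]
      _ = w * S.p := by rw [← Finset.sum_mul, sum_starKernel_hub, one_mul]
  have h4 := Finset.sum_le_sum h3
  rw [Finset.sum_const, card_leaves, nsmul_eq_mul] at h4
  have h5 : (m : ℝ) * (w * S.p) ≤ w * (1 / 8) := by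
    rw [mul_left_comm]
    exact mul_le_mul_of_nonneg_left hp hw0
  simp only [Fintype.sum_bool, if_true, Bool.false_eq_true, if_false]
  rw [← hw]
  linarith

theorem mean_model_zero_le (hp : (m : ℝ) * S.p ≤ 1 / 8) (a : Action V)
    (ha : ∀ i, i.1 = 1 → a ≠ some (i, true)) :
    (S.model 0).mean a ≤ S.α / 2 + 1 / 4 := by
  have hα := S.half_le_α
  by_cases h : ∀ i b, a = some (i, b) → i.1 = 0 ∨ i.1 = 1
  · refine (S.mean_model_zero_le_of_not_leaf hp a h).trans ?_
    by_cases h1 : ∀ i b, a = some (i, b) → i.1 ≠ 1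
    · rw [S.starKernel_bonus a h1, S.starKernel_bonus a h1]
      linarith
    · push Not at h1
      obtain ⟨i, b, rfl, hi⟩ := h1
      cases b
      · simp [starKernel, hi]
        linarith
      · exact absurd rfl (ha i hi)
  · push Not at h
    obtain ⟨i, b, rfl, hi⟩ := h
    exact S.mean_model_zero_le_of_leaf hi.1 hi.2 i rfl b

/-! ### The lower bound -/

theorem lower_bound (hV : ∀ i : Fin (m + 2), i ≠ 0 → i ∈ V) (hp : (m : ℝ) * S.p ≤ 1 / 8) {ε : ℝ}
    (hα : 1 / 2 + 2 * ε < S.α) (hη : S.α / 2 + ε < 1 / 4 + S.η / 8) (hε : 0 < ε)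
    {δ : ℝ} (hδ : 0 < δ) (hδ' : Real.log (1 / δ) ≥ 4) (π : Algorithm V)
    (hπ : IsPAC (S.model '' {k : Fin (m + 2) | k ≠ 1}) ε δ π) :
    ENNReal.ofReal (m * Real.log (1 / δ) / (8 * S.η ^ 2)) ≤ expectedSamples (S.model 0) π := by
  have h10 : (0 : Fin (m + 2)) ≠ 1 := Fin.zero_ne_one
  have hη0 : 0 < S.η := by linarith
  have hN0 : IsNormalized V (S.model 0) := S.isNormalized_model h10
  let b₀ : Action V := some (⟨1, hV 1 h10.symm⟩, true)
  have hopt : ∀ a : Action V, (S.model 0).IsEpsOptimal ε a → a = b₀ := by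
    intro a ha
    by_contra hne
    have h1 := ha b₀
    rw [S.mean_bonus h10 _ rfl] at h1
    have h2 := S.mean_model_zero_le hp a fun i hi h => hne (by
      rw [h]
      simp only [b₀, Option.some.injEq, Prod.mk.injEq, and_true]
      exact Subtype.ext hi)
    linarith
  have hδ4 : δ < 1 / 2 := by
    rw [one_div, Real.log_inv] at hδ'
    have h1 : δ ≤ Real.exp (-4) := (Real.log_le_iff_le_exp hδ).1 (by linarith)
    have h2 : (4 : ℝ) + 1 ≤ Real.exp 4 := Real.add_one_le_exp 4
    rw [Real.exp_neg] at h1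
    have h3 : (Real.exp 4)⁻¹ ≤ (5 : ℝ)⁻¹ := inv_anti₀ (by norm_num) (by linarith)
    norm_num at h3
    linarith
  -- Success on `model 0` forces output `b₀` with probability above `1/2`, and a finite horizon
  -- already captures this. The same `T` serves all leaves.
  obtain ⟨T, hT⟩ : ∃ T, ENNReal.ofReal (1 / 2) < outputBefore (S.model 0) π b₀ T := by
    refine exists_lt_outputBefore hopt (lt_of_lt_of_le ?_ (hπ _ ⟨0, h10, rfl⟩))
    exact (ENNReal.ofReal_lt_ofReal_iff (by linarith)).2 (by linarith)
  have hT' : 1 / 2 < (outputBefore (S.model 0) π b₀ T).toReal :=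
    (ENNReal.ofReal_lt_iff_lt_toReal (by norm_num) (outputBefore_ne_top hN0 _ _)).1 hT
  have hleaf : ∀ k ∈ leaves m, Real.log (1 / δ) / 4 ≤
      weightedSamples (S.model 0) π T (S.infoBound k) := by
    intro k hk
    obtain ⟨hk0, hk1⟩ := mem_leaves.1 hk
    have hNk : IsNormalized V (S.model k) := S.isNormalized_model hk1
    have hnot : ¬ (S.model k).IsEpsOptimal ε b₀ := by
      intro h
      have h1 := h (some (⟨k, hV k hk0⟩, true))
      rw [S.mean_bonus hk1 ⟨1, hV 1 h10.symm⟩ rfl, S.mean_reversed hk0 hk1 _ rfl] at h1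
      linarith
    have hQ : (outputBefore (S.model k) π b₀ T).toReal ≤ δ := by
      have h1 := outputBefore_add_successProb_le (π := π) hNk hnot T
      have h2 := (add_le_add_right (hπ _ ⟨k, hk1, rfl⟩)
        (outputBefore (S.model k) π b₀ T)).trans h1
      have h3 := ENNReal.toReal_mono ENNReal.one_ne_top h2
      rw [ENNReal.toReal_add (outputBefore_ne_top hNk _ _) ENNReal.ofReal_ne_top,
        ENNReal.toReal_ofReal (by linarith), ENNReal.toReal_one] at h3
      linarith
    have h1 := le_weightedSamples (π := π) hN0 hNk
      (L := fun a x => -Real.log (S.ratio k a fun i => x (some i)))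
      (fun a x => by rw [neg_neg, Real.exp_log (S.ratio_pos _ _ _), S.doDist_model hk0 hk1])
      -- Since `model k` outputs `b₀` with probability at most `δ`, this choice bounds the
      -- subtracted term by 1. What remains, `log (1/δ) / 2 - 1`, is at least `log (1/δ) / 4`
      -- because `log (1/δ) ≥ 4`.
      b₀ T (g := Real.log (1 / δ))
    rw [Real.exp_log (by positivity)] at h1
    have h2 : (outputBefore (S.model k) π b₀ T).toReal * (1 / δ) ≤ 1 := by
      rw [mul_one_div, div_le_one hδ]
      exact hQ
    have h3 := weightedSamples_mono (M := S.model 0) (π := π)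
      (S.sum_doDist_mul_neg_log_ratio_le hk0 hk1) T
    nlinarith
  have hsum := Finset.sum_le_sum hleaf
  rw [Finset.sum_const, card_leaves, nsmul_eq_mul, sum_weightedSamples] at hsum
  have hD : 0 < 2 * S.η ^ 2 := by positivity
  refine ofReal_weightedSamples_const_le hN0 T hD ?_
  refine le_trans (le_of_eq ?_)
    (hsum.trans (weightedSamples_mono (S.sum_infoBound_le (by linarith)) T))
  field_simp
  ring

end StarParams

end CausalBandit

/-! ### Choice of the constants -/

theorem mainTheorem6 :
    ∃ c : ℝ, 0 < c ∧ ∃ ε₀ : ℝ, 0 < ε₀ ∧ ∃ δ₀ : ℝ, 0 < δ₀ ∧ ∃ n₀ : ℕ,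
      ∀ n : ℕ, n₀ ≤ n →
      ∀ V : Finset (Fin n), (∀ i : Fin n, (i : ℕ) ≠ 0 → i ∈ V) →
      ∀ ε : ℝ, 0 < ε → ε ≤ ε₀ →
      ∃ (E : Digraph (CausalBandit.Node n)) (P : CausalBandit.Assignment n → ℝ)
        (I : Set (CausalBandit.CausalModel n)),
        (∀ x, 0 < P x) ∧
        (∀ M ∈ I, CausalBandit.essentialGraph M.graph = E ∧ M.obsDist = P) ∧
        Set.InjOn CausalBandit.CausalModel.graph I ∧
        ∀ δ : ℝ, 0 < δ → δ ≤ δ₀ →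
        ∀ π : CausalBandit.Algorithm V, CausalBandit.IsPAC I ε δ π →
        ∃ M ∈ I,
          ENNReal.ofReal (c * ((n : ℝ) / ε ^ 2) * Real.log (1 / δ)) ≤
            CausalBandit.expectedSamples M π := by
  -- `ε₀ = 1/48` keeps `η = 24 ε` at most `1/2`, and `δ₀ = exp (-4)` gives `log (1/δ) ≥ 4`. From `n
  -- ≥ 4` follows `n = m + 2 ≤ 2 m`, so `9216 = 2 * 8 * 24²`.
  refine ⟨1 / 9216, by norm_num, 1 / 48, by norm_num, Real.exp (-4), Real.exp_pos _, 4, ?_⟩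
  intro n hn V hV ε hε hε'
  obtain ⟨m, rfl⟩ : ∃ m, n = m + 2 := ⟨n - 2, by omega⟩
  have hm : (2 : ℝ) ≤ m := by exact_mod_cast (by omega : 2 ≤ m)
  let S : CausalBandit.StarParams :=
    -- The expected number of leaves equal to 1 is `m p = 1/8`. With these `η` and `α`, the safe
    -- action leads every other action by at least `3 ε / 2` in `model 0`, and trails `do(X_k = 1)`
    -- by `3 ε / 2` in `model k`.
    { p := 1 / (8 * (m : ℝ))
      η := 24 * ε
      α := 1 / 2 + 3 * ε
      p_pos := by positivity
      p_le := by
        rw [div_le_div_iff₀ (by positivity) (by norm_num)]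
        linarith
      η_nonneg := by linarith
      η_le := by linarith
      half_le_α := by linarith
      α_lt_one := by linarith }
  refine ⟨CausalBandit.essentialGraph (CausalBandit.starGraph 0), (S.model 0).obsDist,
    S.model '' {k | k ≠ 1}, S.obsDist_pos 0, ?_, ?_, ?_⟩
  · rintro M ⟨k, hk, rfl⟩
    exact ⟨CausalBandit.essentialGraph_starGraph k, S.obsDist_model hk⟩
  · rintro M ⟨k, hk, rfl⟩ M' ⟨l, hl, rfl⟩ h
    rw [CausalBandit.starGraph_injOn hk hl h]
  · intro δ hδ hδ' π hπ
    have hlog : Real.log (1 / δ) ≥ 4 := by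
      rw [one_div, Real.log_inv]
      linarith [(Real.log_le_iff_le_exp hδ).2 hδ']
    refine ⟨S.model 0, ⟨0, Fin.zero_ne_one, rfl⟩, le_trans ?_ (S.lower_bound
      (fun i hi => hV i fun h => hi (Fin.ext h)) ?_ ?_ ?_ hε hδ hlog π hπ)⟩
    · refine ENNReal.ofReal_le_ofReal ?_
      change _ ≤ (m : ℝ) * Real.log (1 / δ) / (8 * (24 * ε) ^ 2)
      have h1 : 1 / 9216 * (((m + 2 : ℕ) : ℝ) / ε ^ 2) * Real.log (1 / δ) =
          ((m : ℝ) + 2) * Real.log (1 / δ) / (9216 * ε ^ 2) := by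
        push_cast
        field_simp
      have h2 : (m : ℝ) * Real.log (1 / δ) / (8 * (24 * ε) ^ 2) =
          2 * m * Real.log (1 / δ) / (9216 * ε ^ 2) := by
        field_simp
        ring
      rw [h1, h2]
      gcongr
      linarith
    · change (m : ℝ) * (1 / (8 * (m : ℝ))) ≤ 1 / 8
      refine le_of_eq ?_
      field_simp
    · change 1 / 2 + 2 * ε < 1 / 2 + 3 * ε
      linarith
    · change (1 / 2 + 3 * ε) / 2 + ε < 1 / 4 + 24 * ε / 8
      linarith
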